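/- **Syntax.** Let $FS$ and $CS$ be disjoint alphabets of function and constructor symbols, each symbol $h$ with an arity $ar(h)\in\mathbb N$, containing infinitely many function symbols and infinitely many constructor symbols of every arity, and let $\mathcal V$ be an infinite set of variables. Expressions are $e ::= X \mid h \mid (e_1\,e_2)$ with $X\in\mathcal V$, $h\in FS\cup CS$ (application associates to the left); patterns are $t ::= X \mid c\,t_1\ldots t_n \mid f\,t_1\ldots t_m$ with $n\le ar(c)$, $m<ar(f)$; first-order patterns are $t ::= X\mid c\,t_1\ldots t_n$ with $n=ar(c)$. Contexts are $\mathcal C ::= [\,]\mid \mathcal C\,e\mid e\,\mathcal C$. Partial expressions, patterns and pattern substitutions may also use an additional constructor $\bot$ of arity $0$. A program is a finite set of rules $f\,p_1\ldots p_n\to r$ with $f\in FS$, $n=ar(f)$, $p_1,\ldots,p_n$ patterns in which no variable occurs twice, $r$ an expression, and without extra variables: $var(r)\subseteq var(f\,p_1\ldots p_n)$. **Semantics.** For a program $\mathcal P$ let $e\rightarrowtriangle t$ be the least relation on partial expressions such that: (B) $e\rightarrowtriangle\bot$; (RR) $X\rightarrowtriangle X$ for $X\in\mathcal V$; (DC)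 $h\,e_1\ldots e_m\rightarrowtriangle h\,t_1\ldots t_m$ if $h\in FS\cup CS$, $e_i\rightarrowtriangle t_i$ for all $i$, and $h\,t_1\ldots t_m$ is a partial pattern; (OR) $f\,e_1\ldots e_n\,a_1\ldots a_m\rightarrowtriangle t$ if $(f\,p_1\ldots p_n\to r)\in\mathcal P$, $\theta$ is a partial pattern substitution, $e_i\rightarrowtriangle p_i\theta$ for all $i$, and $r\theta\,a_1\ldots a_m\rightarrowtriangle t$. The HOCRWL denotation of $e$ is $[\![e]\!]^{\mathcal P}=\{t \text{ a partial pattern}\mid e\rightarrowtriangle t\}$. **Observations.** Let-expressions are $e ::= X\mid h\mid (e_1\,e_2)\mid \mathit{let}\ X=e_1\ \mathit{in}\ e_2$, up to renaming of bound variables, where $X$ is bound in $e_2$ only. HOlet-rewriting by $\mathcal P$ is the closure under arbitrary contexts (without capture of variables) of the rules: - (Fapp) $f\,p_1\theta\ldots p_n\theta\to r\theta$ for $(f\,p_1\ldots p_n\to r)\in\mathcal P$ and $\theta$ a pattern substitution; - (LetIn) $e_1\,e_2\to \mathit{let}\ X=e_2\ \mathit{in}\ e_1\,X$ with $X$ fresh,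 if $e_2$ is of the form $f\,a_1\ldots a_m$ with $m\ge ar(f)$, or $c\,a_1\ldots a_m$ with $m>ar(c)$, or $Y\,a_1\ldots a_m$ with $m>0$, or is a $\mathit{let}$; - (Bind) $\mathit{let}\ X=t\ \mathit{in}\ e\to e[X/t]$ for $t$ a pattern; - (Elim) $\mathit{let}\ X=e_1\ \mathit{in}\ e_2\to e_2$ if $X$ is not free in $e_2$; - (Flat) $\mathit{let}\ X=(\mathit{let}\ Y=e_1\ \mathit{in}\ e_2)\ \mathit{in}\ e_3\to \mathit{let}\ Y=e_1\ \mathit{in}\ (\mathit{let}\ X=e_2\ \mathit{in}\ e_3)$ if $Y$ is not free in $e_3$; - (LetAp) $(\mathit{let}\ X=e_1\ \mathit{in}\ e_2)\,e_3\to \mathit{let}\ X=e_1\ \mathit{in}\ (e_2\,e_3)$ if $X$ is not free in $e_3$. For an expression $e$, $\mathrm{obs}^{\mathcal P}(e)$ is the set of patterns (without $\bot$) reachable from $e$ by finitely many HOlet-rewriting steps, and $\mathrm{obs}_{FO}^{\mathcal P}(e)$ is the set of first-order patterns so reachable. **Safe extensions.** A program $\mathcal P'$ is a safe extension of $(\mathcal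 P,e)$ if $\mathcal P'=\mathcal P\cup\mathcal P''$ where no rule of $\mathcal P''$ defines (has at the root of its left-hand side) a function symbol occurring in $\mathcal P$ or in $e$. **Theorem (Full abstraction).** The HOCRWL semantics $[\![\cdot]\!]$ is fully abstract with respect to $\mathrm{obs}$ and with respect to $\mathrm{obs}_{FO}$. That is, for each $\mathcal O\in\{\mathrm{obs},\mathrm{obs}_{FO}\}$, every program $\mathcal P$ and all expressions $e,e'$ (without $\bot$), the following are equivalent: 1. $[\![e]\!]^{\mathcal P}=[\![e']\!]^{\mathcal P}$; 2. $\mathcal O^{\mathcal P'}(\mathcal C[e])=\mathcal O^{\mathcal P'}(\mathcal C[e'])$ for every program $\mathcal P'$ that is a safe extension of both $(\mathcal P,e)$ and $(\mathcal P,e')$, and every context $\mathcal C$ all of whose symbols occur in $\mathcal P'$. -/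

import Mathlib

universe u v w

namespace HOCRWL

/-- A signature: function symbols and constructor symbols, each with an arity. -/
structure Signature where
  FS : Type u
  CS : Type v
  arF : FS → ℕ
  arC : CS → ℕ

namespace Signature

/-- Symbols `h ∈ FS ∪ CS` (the two alphabets are disjoint). -/
abbrev Sym (S : Signature.{u, v}) : Type (max u v) := S.FS ⊕ S.CS

/-- The signature enlarged with a new constructor `⊥` (here `none`) of arity `0`. -/
abbrev withBot (S : Signature.{u, v}) : Signature.{u, v} where
  FS := S.FS
  CS := Option S.CS
  arF := S.arF
  arC := fun c => c.elim 0 S.arC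

/-- A symbol of the signature, seen in the enlarged signature. -/
def symToBot (S : Signature.{u, v}) : S.Sym → S.withBot.Sym :=
  Sum.map id some

/-- `h t₁ … tₘ` is allowed as a pattern: `m < ar(h)` for functions, `m ≤ ar(h)` for constructors. -/
def PatArity (S : Signature.{u, v}) : S.Sym → ℕ → Prop
  | Sum.inl f, m => m < S.arF f
  | Sum.inr c, m => m ≤ S.arC c

end Signature

/-! ### Expressions, patterns, contexts -/

/-- Applicative expressions `e ::= X | h | (e₁ e₂)`.
Partial expressions are the expressions over `S.withBot`. -/
inductive Exp (S : Signature.{u, v}) (V : Type w) : Type (max u v w)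
  | var (x : V) : Exp S V
  | sym (h : S.Sym) : Exp S V
  | app (e₁ e₂ : Exp S V) : Exp S V

/-- Partial expressions `Exp_⊥`. -/
abbrev PExp (S : Signature.{u, v}) (V : Type w) : Type (max u v w) := Exp S.withBot V

namespace Exp

variable {S : Signature.{u, v}} {V : Type w}

/-- `e e₁ … eₘ`, left-associated application to a list of arguments. -/
def apps (e : Exp S V) (es : List (Exp S V)) : Exp S V := es.foldl app e

/-- The list of variable occurrences. -/
def vars : Exp S V → List V
  | var x => [x]
  | sym _ => []
  | app e₁ e₂ => e₁.vars ++ e₂.vars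

/-- The set of symbols occurring in an expression. -/
def syms : Exp S V → Set S.Sym
  | var _ => ∅
  | sym h => {h}
  | app e₁ e₂ => e₁.syms ∪ e₂.syms

/-- Application of a substitution. -/
def subst (θ : V → Exp S V) : Exp S V → Exp S V
  | var x => θ x
  | sym h => sym h
  | app e₁ e₂ => app (e₁.subst θ) (e₂.subst θ)

/-- The inclusion of `Exp` in `Exp_⊥`. -/
def toBot : Exp S V → PExp S V
  | var x => var x
  | sym h => sym (S.symToBot h)
  | app e₁ e₂ => app e₁.toBot e₂.toBot

/-- The partial expression `⊥`. -/
def bot : PExp S V := sym (Sum.inr none)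

/-- Patterns `t ::= X | c t₁ … tₙ | f t₁ … tₘ` with `n ≤ ar(c)`, `m < ar(f)`. -/
inductive IsPat : Exp S V → Prop
  | var (x : V) : IsPat (var x)
  | apps (h : S.Sym) (ts : List (Exp S V)) :
      S.PatArity h ts.length → (∀ t ∈ ts, IsPat t) → IsPat ((sym h).apps ts)

/-- First-order patterns `t ::= X | c t₁ … tₙ` with `n = ar(c)`. -/
inductive IsFOPat : Exp S V → Prop
  | var (x : V) : IsFOPat (var x)
  | apps (c : S.CS) (ts : List (Exp S V)) :
      ts.length = S.arC c → (∀ t ∈ ts, IsFOPat t) → IsFOPat ((sym (Sum.inr c)).apps ts)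

end Exp

/-- One-hole contexts `C ::= [ ] | C e | e C`. -/
inductive Cntxt (S : Signature.{u, v}) (V : Type w) : Type (max u v w)
  | hole : Cntxt S V
  | appL (C : Cntxt S V) (e : Exp S V) : Cntxt S V
  | appR (e : Exp S V) (C : Cntxt S V) : Cntxt S V

namespace Cntxt

variable {S : Signature.{u, v}} {V : Type w}

/-- `C[e]`. -/
def fill : Cntxt S V → Exp S V → Exp S V
  | hole, e => e
  | appL C e', e => Exp.app (C.fill e) e'
  | appR e' C, e => Exp.app e' (C.fill e)

/-- The set of symbols occurring in a context. -/
def syms : Cntxt S V → Set S.Sym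
  | hole => ∅
  | appL C e => C.syms ∪ e.syms
  | appR e C => e.syms ∪ C.syms

end Cntxt

/-! ### Programs -/

/-- A program rule `f t₁ … tₙ → r`: `n = ar(f)`, the `tᵢ` are patterns, and no variable
occurs twice in `t₁, …, tₙ`. -/
structure Rule (S : Signature.{u, v}) (V : Type w) where
  fn : S.FS
  args : List (Exp S V)
  rhs : Exp S V
  length_args : args.length = S.arF fn
  isPat_args : ∀ t ∈ args, t.IsPat
  linear : (args.flatMap Exp.vars).Nodup

namespace Rule

variable {S : Signature.{u, v}} {V : Type w}

/-- The left-hand side `f t₁ … tₙ`. -/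
def lhs (ρ : Rule S V) : Exp S V := (Exp.sym (Sum.inl ρ.fn)).apps ρ.args

/-- `var(r) ⊆ var(f t₁ … tₙ)`. -/
def NoExtraVars (ρ : Rule S V) : Prop := ∀ x ∈ ρ.rhs.vars, x ∈ ρ.lhs.vars

/-- The symbols occurring in a rule. -/
def syms (ρ : Rule S V) : Set S.Sym := ρ.lhs.syms ∪ ρ.rhs.syms

end Rule

/-- A program: a finite set of program rules without extra variables. -/
structure Program (S : Signature.{u, v}) (V : Type w) where
  rules : Set (Rule S V)
  finite : rules.Finite
  noExtraVars : ∀ ρ ∈ rules, ρ.NoExtraVars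

namespace Program

variable {S : Signature.{u, v}} {V : Type w}

/-- The signature of a program: the symbols occurring in its rules. -/
def syms (P : Program S V) : Set S.Sym := {h | ∃ ρ ∈ P.rules, h ∈ ρ.syms}

/-- `P'` is a safe extension of `(P, e)`: `P' = P ∪ P''` where `P''` has no defining rule for a
function symbol occurring in `P` or in `e`. -/
def SafeExtension (P : Program S V) (e : Exp S V) (P' : Program S V) : Prop :=
  ∃ P'' : Set (Rule S V), P'.rules = P.rules ∪ P'' ∧
    ∀ ρ ∈ P'', (Sum.inl ρ.fn : S.Sym) ∉ P.syms ∧ (Sum.inl ρ.fn : S.Sym) ∉ e.syms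

end Program

/-! ### The HOCRWL proof calculus and the denotation -/

section Calculus

variable {S : Signature.{u, v}} {V : Type w}

/-- `Derives P e t`: the statement `e ⇾ t` is derivable in the HOCRWL-calculus from `P`.
In `OR` only the values of `θ` on the finitely many variables of the rule matter, so `θ` may be
any total map into partial patterns. -/
inductive Derives (P : Program S V) : PExp S V → PExp S V → Prop
  | B (e : PExp S V) : Derives P e Exp.bot
  | RR (x : V) : Derives P (Exp.var x) (Exp.var x)
  | DC (h : S.Sym) (es ts : List (PExp S V)) :
      es.length = ts.length →
      (∀ p ∈ es.zip ts, Derives P p.1 p.2) →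
      ((Exp.sym (S.symToBot h)).apps ts).IsPat →
      Derives P ((Exp.sym (S.symToBot h)).apps es) ((Exp.sym (S.symToBot h)).apps ts)
  | OR (ρ : Rule S V) (θ : V → PExp S V) (es as : List (PExp S V)) (t : PExp S V) :
      ρ ∈ P.rules →
      (∀ x, (θ x).IsPat) →
      es.length = ρ.args.length →
      (∀ p ∈ es.zip ρ.args, Derives P p.1 (p.2.toBot.subst θ)) →
      Derives P ((ρ.rhs.toBot.subst θ).apps as) t →
      Derives P ((Exp.sym (S.symToBot (Sum.inl ρ.fn))).apps (es ++ as)) t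

/-- The HOCRWL-denotation `⟦e⟧^P = {t ∈ Pat_⊥ | P ⊢ e ⇾ t}` of a partial expression. -/
def denP (P : Program S V) (e : PExp S V) : Set (PExp S V) :=
  {t | t.IsPat ∧ Derives P e t}

/-- The HOCRWL-denotation of a total expression. -/
def den (P : Program S V) (e : Exp S V) : Set (PExp S V) := denP P e.toBot

end Calculus

/-! ### HOlet-rewriting -/

/-- Let-expressions `e ::= X | h | (e₁ e₂) | let X = e₁ in e₂`, up to renaming of bound variables:
variables bound by a `let` are de Bruijn indices, and `letin e₁ e₂` binds the index `0` in `e₂`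
(and nothing in `e₁`). -/
inductive LExp (S : Signature.{u, v}) (V : Type w) : Type (max u v w)
  | fvar (x : V) : LExp S V
  | bvar (i : ℕ) : LExp S V
  | sym (h : S.Sym) : LExp S V
  | app (e₁ e₂ : LExp S V) : LExp S V
  | letin (e₁ e₂ : LExp S V) : LExp S V

namespace LExp

variable {S : Signature.{u, v}} {V : Type w}

/-- `e e₁ … eₘ`. -/
def apps (e : LExp S V) (es : List (LExp S V)) : LExp S V := es.foldl app e

/-- A renaming of indices, carried under one binder. -/
def upRen (r : ℕ → ℕ) : ℕ → ℕ
  | 0 => 0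
  | i + 1 => r i + 1

/-- Renaming of indices. -/
def rename (r : ℕ → ℕ) : LExp S V → LExp S V
  | fvar x => fvar x
  | bvar i => bvar (r i)
  | sym h => sym h
  | app e₁ e₂ => app (e₁.rename r) (e₂.rename r)
  | letin e₁ e₂ => letin (e₁.rename r) (e₂.rename (upRen r))

/-- Weakening: `e` placed under one more binder, whose variable does not occur in it. -/
def shift (e : LExp S V) : LExp S V := e.rename Nat.succ

/-- Weakening below the innermost binder: index `0` stays, the new binder is index `1`. -/
def shiftOne (e : LExp S V) : LExp S V := e.rename (upRen Nat.succ)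

/-- A substitution for indices, carried under one binder. -/
def upSub (σ : ℕ → LExp S V) : ℕ → LExp S V
  | 0 => bvar 0
  | i + 1 => (σ i).shift

/-- Capture-avoiding simultaneous substitution for indices. -/
def substB (σ : ℕ → LExp S V) : LExp S V → LExp S V
  | fvar x => fvar x
  | bvar i => σ i
  | sym h => sym h
  | app e₁ e₂ => app (e₁.substB σ) (e₂.substB σ)
  | letin e₁ e₂ => letin (e₁.substB σ) (e₂.substB (upSub σ))

/-- `e[X/t]` for `X` the variable of the innermost binder around `e`, which is removed. -/
def inst (e t : LExp S V) : LExp S V :=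
  e.substB fun i => Nat.casesOn i t bvar

/-- Patterns among the let-expressions; variables may be free or bound further out. -/
inductive IsPat : LExp S V → Prop
  | fvar (x : V) : IsPat (fvar x)
  | bvar (i : ℕ) : IsPat (bvar i)
  | apps (h : S.Sym) (ts : List (LExp S V)) :
      S.PatArity h ts.length → (∀ t ∈ ts, IsPat t) → IsPat ((sym h).apps ts)

/-- The argument expressions that get a `let` of their own: active expressions `f e₁ … eₘ` with
`m ≥ ar(f)`, junk expressions `c e₁ … eₘ` with `m > ar(c)`, variable applications `X e₁ … eₘ`
with `m > 0`, and expressions rooted by `let`. -/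
inductive Shareable : LExp S V → Prop
  | active (f : S.FS) (es : List (LExp S V)) :
      S.arF f ≤ es.length → Shareable ((sym (Sum.inl f)).apps es)
  | junk (c : S.CS) (es : List (LExp S V)) :
      S.arC c < es.length → Shareable ((sym (Sum.inr c)).apps es)
  | fvarApp (x : V) (es : List (LExp S V)) : es ≠ [] → Shareable ((fvar x).apps es)
  | bvarApp (i : ℕ) (es : List (LExp S V)) : es ≠ [] → Shareable ((bvar i).apps es)
  | letin (e₁ e₂ : LExp S V) : Shareable (letin e₁ e₂)

end LExp

namespace Exp

variable {S : Signature.{u, v}} {V : Type w}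

/-- `eθ` for an expression `e` without `let` and `θ` a substitution by let-expressions. -/
def substL (θ : V → LExp S V) : Exp S V → LExp S V
  | var x => θ x
  | sym h => LExp.sym h
  | app e₁ e₂ => LExp.app (e₁.substL θ) (e₂.substL θ)

/-- The inclusion of expressions in let-expressions. -/
def toL (e : Exp S V) : LExp S V := e.substL LExp.fvar

end Exp

section Rewriting

variable {S : Signature.{u, v}} {V : Type w}

/-- One step of HOlet-rewriting. The last four constructors close the rules under contexts
(`Contx`); as programs have no extra variables, a step `Fapp` inside a context cannot introduce
variables that the context captures. -/
inductive LetStep (P : Program S V) : LExp S V → LExp S V → Prop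
  /-- `f p₁θ … pₙθ → rθ` for a rule `f p₁ … pₙ → r` and a pattern substitution `θ`. -/
  | Fapp (ρ : Rule S V) (θ : V → LExp S V) :
      ρ ∈ P.rules → (∀ x, (θ x).IsPat) → LetStep P (ρ.lhs.substL θ) (ρ.rhs.substL θ)
  /-- `e₁ e₂ → let X = e₂ in e₁ X`, with `X` fresh. -/
  | LetIn (e₁ e₂ : LExp S V) :
      e₂.Shareable →
      LetStep P (LExp.app e₁ e₂) (LExp.letin e₂ (LExp.app e₁.shift (LExp.bvar 0)))
  /-- `let X = t in e → e[X/t]` for a pattern `t`. -/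
  | Bind (t e : LExp S V) : t.IsPat → LetStep P (LExp.letin t e) (e.inst t)
  /-- `let X = e₁ in e₂ → e₂` if `X` is not free in `e₂`. -/
  | Elim (e₁ e₂ : LExp S V) : LetStep P (LExp.letin e₁ e₂.shift) e₂
  /-- `let X = (let Y = e₁ in e₂) in e₃ → let Y = e₁ in (let X = e₂ in e₃)`,
  with `Y` not free in `e₃`. -/
  | Flat (e₁ e₂ e₃ : LExp S V) :
      LetStep P (LExp.letin (LExp.letin e₁ e₂) e₃)
        (LExp.letin e₁ (LExp.letin e₂ e₃.shiftOne))
  /-- `(let X = e₁ in e₂) e₃ → let X = e₁ in e₂ e₃`, with `X` not free in `e₃`. -/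
  | LetAp (e₁ e₂ e₃ : LExp S V) :
      LetStep P (LExp.app (LExp.letin e₁ e₂) e₃) (LExp.letin e₁ (LExp.app e₂ e₃.shift))
  | appL (e e' a : LExp S V) : LetStep P e e' → LetStep P (LExp.app e a) (LExp.app e' a)
  | appR (a e e' : LExp S V) : LetStep P e e' → LetStep P (LExp.app a e) (LExp.app a e')
  | letL (e e' a : LExp S V) : LetStep P e e' → LetStep P (LExp.letin e a) (LExp.letin e' a)
  | letR (a e e' : LExp S V) : LetStep P e e' → LetStep P (LExp.letin a e) (LExp.letin a e')

/-- `P ⊢ e →* t` for HOlet-rewriting. -/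
def LetRewrites (P : Program S V) (e t : Exp S V) : Prop :=
  Relation.ReflTransGen (LetStep P) e.toL t.toL

/-! ### Observations and full abstraction -/

/-- The patterns reached from `e` by HOlet-rewriting. -/
def obs (P : Program S V) (e : Exp S V) : Set (Exp S V) :=
  {t | t.IsPat ∧ LetRewrites P e t}

/-- The first-order patterns reached from `e` by HOlet-rewriting. -/
def obsFO (P : Program S V) (e : Exp S V) : Set (Exp S V) :=
  {t | t.IsFOPat ∧ LetRewrites P e t}

/-- The semantics `D` is fully abstract with respect to the observation `O`. -/
def FullyAbstract {α β : Type*} (D : Program S V → Exp S V → Set α)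
    (O : Program S V → Exp S V → Set β) : Prop :=
  ∀ (P : Program S V) (e e' : Exp S V),
    D P e = D P e' ↔
      ∀ P' : Program S V, P.SafeExtension e P' → P.SafeExtension e' P' →
        ∀ C : Cntxt S V, C.syms ⊆ P'.syms → O P' (C.fill e) = O P' (C.fill e')

end Rewriting

end HOCRWL

/-! By `letRewrites_iff`, HOlet-rewriting reaches a pattern `t` from `e` exactly when `e ⇾ t`, so
both observations are parts of the denotation and full abstraction becomes a statement about the
calculus alone.

Equal denotations give equal observations because the denotation is compositional: by
`Derives.app_iff` the values of `e₁ e₂` are those of `t₁ t₂` for values `tᵢ` of `eᵢ`. A safe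
extension gives `e` no new values (`Program.SafeExtension.derives_iff`), since without extra
variables a derivation never meets a symbol, other than `⊥`, outside the program and the expression.

Conversely, let `t` be a value of `e` and not of `e'`. Replace every occurrence of a variable or of
`⊥` in `t` by a new variable to get a linear pattern `p`; let `yᵢ` be the new variables at the
occurrences `xᵢ` of variables. Add the rule `g p → d y₁ … yₖ` with `g` fresh. Then `g e` reaches `d
x₁ … xₖ`. If `g e'` did, `e'` would have a value `pθ` with `yᵢθ = xᵢ`, and `t` is a value of `pθ`,
hence of `e'`. The pattern observed is first-order, so the argument serves both observations.

Soundness of rewriting: `Sem` assigns values to let-expressions, one shared value per binding, and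
no step creates a value (`LetStep.sem_subset`). Completeness: in a derivation `⊥` marks a part that
is never evaluated, so anything may stand there (`Cover`). `Derives.simulate` follows the derivation
by rewriting; unevaluated arguments are parked in bindings that float outwards (`Ev`) and are
dropped at the end. -/

namespace HOCRWL

variable {S : Signature.{u, v}} {V : Type w}

/-! ### Applicative expressions and patterns -/

namespace Exp

theorem apps_append (e : Exp S V) (as bs : List (Exp S V)) :
    e.apps (as ++ bs) = (e.apps as).apps bs := List.foldl_append

theorem apps_concat (e : Exp S V) (as : List (Exp S V)) (b : Exp S V) :
    e.apps (as ++ [b]) = app (e.apps as) b := by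
  rw [apps_append]; rfl

theorem sym_apps_inj {h h' : S.Sym} {as bs : List (Exp S V)}
    (H : (sym h).apps as = (sym h').apps bs) : h = h' ∧ as = bs := by
  induction as using List.reverseRecOn generalizing bs with
  | nil =>
    rcases List.eq_nil_or_concat' bs with rfl | ⟨bs, b, rfl⟩
    · exact ⟨by injection H, rfl⟩
    · rw [apps_concat] at H; exact nomatch H
  | append_singleton as a ih =>
    rcases List.eq_nil_or_concat' bs with rfl | ⟨bs, b, rfl⟩
    · rw [apps_concat] at H; exact nomatch H
    · rw [apps_concat, apps_concat] at H
      injection H with H1 H2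
      obtain ⟨rfl, rfl⟩ := ih H1
      exact ⟨rfl, by rw [H2]⟩

theorem app_eq_sym_apps {h : S.Sym} {e₁ e₂ : Exp S V} {as : List (Exp S V)}
    (H : app e₁ e₂ = (sym h).apps as) : ∃ bs, as = bs ++ [e₂] ∧ e₁ = (sym h).apps bs := by
  rcases List.eq_nil_or_concat' as with rfl | ⟨bs, b, rfl⟩
  · exact nomatch H
  · rw [apps_concat] at H
    injection H with H1 H2
    exact ⟨bs, by rw [H2], H1⟩

theorem var_ne_sym_apps {h : S.Sym} {x : V} {as : List (Exp S V)} :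
    var x ≠ (sym h).apps as := by
  intro H
  rcases List.eq_nil_or_concat' as with rfl | ⟨bs, b, rfl⟩
  · exact nomatch H
  · rw [apps_concat] at H; exact nomatch H

theorem symToBot_injective : Function.Injective S.symToBot :=
  Function.injective_id.sumMap (Option.some_injective _)

theorem symToBot_ne_bot (h : S.Sym) : S.symToBot h ≠ Sum.inr none := by
  rcases h with f | c <;> simp [Signature.symToBot]

theorem patArity_symToBot {h : S.Sym} {n : ℕ} :
    S.withBot.PatArity (S.symToBot h) n ↔ S.PatArity h n := by
  rcases h with f | c <;> exact Iff.rfl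

theorem patArity_mono {h : S.Sym} {m n : ℕ} (hmn : m ≤ n) (H : S.PatArity h n) :
    S.PatArity h m := by
  rcases h with f | c
  · exact lt_of_le_of_lt hmn H
  · exact le_trans hmn H

theorem eq_bot_or_symToBot (h : S.withBot.Sym) : h = Sum.inr none ∨ ∃ g, h = S.symToBot g := by
  rcases h with f | _ | c
  · exact Or.inr ⟨Sum.inl f, rfl⟩
  · exact Or.inl rfl
  · exact Or.inr ⟨Sum.inr c, rfl⟩

theorem sym_apps_ne_bot {h : S.Sym} {es : List (PExp S V)} :
    (sym (S.symToBot h)).apps es ≠ bot := by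
  intro H
  exact symToBot_ne_bot h (sym_apps_inj (bs := []) H).1

theorem isPat_sym_apps_iff {h : S.Sym} {ts : List (Exp S V)} :
    ((sym h).apps ts).IsPat ↔ S.PatArity h ts.length ∧ ∀ t ∈ ts, t.IsPat := by
  refine ⟨fun H => ?_, fun H => .apps h ts H.1 H.2⟩
  generalize he : (sym h).apps ts = e at H
  cases H with
  | var x => exact absurd he.symm var_ne_sym_apps
  | apps h' ts' h1 h2 =>
    obtain ⟨rfl, rfl⟩ := sym_apps_inj he
    exact ⟨h1, h2⟩

theorem isPat_app {e₁ e₂ : Exp S V} (H : (app e₁ e₂).IsPat) :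
    e₁.IsPat ∧ e₂.IsPat ∧ ∃ h ts, e₁ = (sym h).apps ts := by
  generalize he : app e₁ e₂ = e at H
  cases H with
  | var x => exact nomatch he
  | apps h ts h1 h2 =>
    obtain ⟨bs, rfl, rfl⟩ := app_eq_sym_apps he
    refine ⟨.apps h bs (patArity_mono (by simp) h1) fun t ht => h2 t (by simp [ht]),
      h2 _ (by simp), h, bs, rfl⟩

theorem isPat_bot : (bot : PExp S V).IsPat :=
  IsPat.apps (S := S.withBot) (Sum.inr none) [] (Nat.zero_le _) (by simp)

theorem toBot_apps (e : Exp S V) (es : List (Exp S V)) :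
    (e.apps es).toBot = e.toBot.apps (es.map toBot) := by
  induction es generalizing e with
  | nil => rfl
  | cons a es ih => exact ih (app e a)

theorem subst_apps (θ : V → Exp S V) (e : Exp S V) (es : List (Exp S V)) :
    (e.apps es).subst θ = (e.subst θ).apps (es.map (subst θ)) := by
  induction es generalizing e with
  | nil => rfl
  | cons a es ih => exact ih (app e a)

theorem vars_apps (e : Exp S V) (es : List (Exp S V)) :
    (e.apps es).vars = e.vars ++ es.flatMap vars := by
  induction es generalizing e with
  | nil => simp [apps]
  | cons a es ih => exact (ih (app e a)).trans (by simp [vars])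

theorem mem_syms_apps {h : S.Sym} {e : Exp S V} {es : List (Exp S V)} :
    h ∈ (e.apps es).syms ↔ h ∈ e.syms ∨ ∃ a ∈ es, h ∈ a.syms := by
  induction es generalizing e with
  | nil => simp [apps]
  | cons a es ih => exact (ih (e := app e a)).trans (by simp [syms, or_assoc])

theorem subst_var (e : Exp S V) : e.subst var = e := by
  induction e with
  | var x => rfl
  | sym h => rfl
  | app e₁ e₂ ih₁ ih₂ => simp [subst, ih₁, ih₂]

theorem mem_syms_toBot_subst {h : S.withBot.Sym} {θ : V → PExp S V} {e : Exp S V} :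
    h ∈ (e.toBot.subst θ).syms ↔
      (∃ g ∈ e.syms, h = S.symToBot g) ∨ ∃ x ∈ e.vars, h ∈ (θ x).syms := by
  induction e with
  | var x => simp [toBot, subst, syms, vars]
  | sym g => simp [toBot, subst, syms, vars]
  | app e₁ e₂ ih₁ ih₂ =>
    simp only [toBot, subst, syms, vars, Set.mem_union, ih₁, ih₂, List.mem_append]
    grind

theorem toBot_isPat {e : Exp S V} (H : e.IsPat) : e.toBot.IsPat := by
  induction H with
  | var x => exact .var x
  | apps h ts h1 h2 ih =>
    rw [toBot_apps]
    refine .apps _ _ (by simpa using patArity_symToBot.2 h1) ?_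
    simpa using ih

theorem IsFOPat.isPat {e : Exp S V} (H : e.IsFOPat) : e.IsPat := by
  induction H with
  | var x => exact .var x
  | apps c ts h1 h2 ih => exact .apps _ _ h1.le ih

end Exp

theorem Rule.vars_lhs (ρ : Rule S V) : ρ.lhs.vars = ρ.args.flatMap Exp.vars := by
  simp [Rule.lhs, Exp.vars_apps, Exp.vars]

open Exp

theorem forall_mem_zip_snd {α β : Type*} {as : List α} {bs : List β} (hl : as.length = bs.length)
    {Q : β → Prop} (H : ∀ p ∈ as.zip bs, Q p.2) : ∀ b ∈ bs, Q b := by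
  intro b hb
  obtain ⟨i, hi, rfl⟩ := List.getElem_of_mem hb
  have : (as[i], bs[i]) ∈ as.zip bs := by
    rw [← List.getElem_zip (h := by simp; omega)]; exact List.getElem_mem _
  exact H _ this

theorem mem_zip_self {α : Type*} {as : List α} {p : α × α} (hp : p ∈ as.zip as) :
    ∃ a ∈ as, p = (a, a) := by
  obtain ⟨i, hi, rfl⟩ := List.getElem_of_mem hp
  exact ⟨as[i]'(by simpa using hi), List.getElem_mem _, by simp⟩

/-! ### The calculus: transitivity, compositionality, safe extensions -/

namespace Derives

variable {P P' : Program S V}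

theorem isPat {e t : PExp S V} (H : Derives P e t) : t.IsPat := by
  induction H with
  | B e => exact isPat_bot
  | RR x => exact .var x
  | DC h es ts hl hd hp ih => exact hp
  | OR ρ θ es as t hρ hθ hl hd hr ih ihr => exact ihr

theorem refl {t : PExp S V} (H : t.IsPat) : Derives P t t := by
  induction H with
  | var x => exact .RR x
  | apps h ts h1 h2 ih =>
    rcases eq_bot_or_symToBot h with rfl | ⟨g, rfl⟩
    · obtain rfl : ts = [] := List.eq_nil_of_length_eq_zero (Nat.le_zero.1 h1)
      exact .B _
    · refine .DC g ts ts rfl (fun p hp => ?_) (.apps _ _ h1 h2)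
      obtain ⟨a, ha, rfl⟩ := mem_zip_self hp
      exact ih a ha

/-- Inversion of a derivation from `h e₁ … eₘ`. -/
theorem sym_apps_inv {h : S.Sym} {es : List (PExp S V)} {t : PExp S V}
    (H : Derives P ((sym (S.symToBot h)).apps es) t) :
    t = bot ∨
    (∃ ts, es.length = ts.length ∧ (∀ p ∈ es.zip ts, Derives P p.1 p.2) ∧
      t = (sym (S.symToBot h)).apps ts) ∨
    ∃ (ρ : Rule S V) (θ : V → PExp S V) (us as : List (PExp S V)), ρ ∈ P.rules ∧
      h = Sum.inl ρ.fn ∧ es = us ++ as ∧ (∀ x, (θ x).IsPat) ∧ us.length = ρ.args.length ∧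
      (∀ p ∈ us.zip ρ.args, Derives P p.1 (p.2.toBot.subst θ)) ∧
      Derives P ((ρ.rhs.toBot.subst θ).apps as) t := by
  generalize he : (sym (S.symToBot h)).apps es = e at H
  cases H with
  | B e => exact Or.inl rfl
  | RR x => exact absurd he.symm var_ne_sym_apps
  | DC h' es' ts hl hd hp =>
    obtain ⟨hh, rfl⟩ := sym_apps_inj he
    obtain rfl := symToBot_injective hh
    exact Or.inr (Or.inl ⟨ts, hl, hd, rfl⟩)
  | OR ρ θ us as t hρ hθ hl hd hr =>
    obtain ⟨hh, rfl⟩ := sym_apps_inj he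
    exact Or.inr (Or.inr ⟨ρ, θ, us, as, hρ, symToBot_injective hh, rfl, hθ, hl, hd, hr⟩)

/-- `DC` and `OR` need a symbol other than `⊥` at the head and `RR` a bare variable, so only `B`
remains. This settles `⊥`, and `⊥` or a variable applied to an argument. -/
theorem eq_bot_of_head {e t : PExp S V}
    (he : ∀ h es, e ≠ (sym (S.symToBot h)).apps es) (hv : ∀ x, e ≠ var x)
    (H : Derives P e t) : t = bot := by
  cases H with
  | B e => rfl
  | RR x => exact absurd rfl (hv x)
  | DC h' es' ts hl hd hp => exact absurd rfl (he _ _)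
  | OR ρ θ us as t hρ hθ hl hd hr => exact absurd rfl (he _ _)

theorem of_bot {t : PExp S V} (H : Derives P bot t) : t = bot :=
  eq_bot_of_head (fun _ _ => sym_apps_ne_bot.symm) (fun _ h => by cases h) H

theorem of_var {x : V} {t : PExp S V} (H : Derives P (var x) t) : t = bot ∨ t = var x := by
  generalize he : var x = e at H
  cases H with
  | B e => exact Or.inl rfl
  | RR y => exact Or.inr rfl
  | DC h' es' ts hl hd hp => exact absurd he var_ne_sym_apps
  | OR ρ θ us as t hρ hθ hl hd hr => exact absurd he var_ne_sym_apps

theorem of_bot_app {a t : PExp S V} (H : Derives P (app bot a) t) : t = bot := by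
  refine eq_bot_of_head (fun h es he => ?_) (fun _ h => by cases h) H
  obtain ⟨bs, -, hb⟩ := app_eq_sym_apps he
  exact sym_apps_ne_bot hb.symm

theorem of_var_app {x : V} {a t : PExp S V} (H : Derives P (app (var x) a) t) : t = bot := by
  refine eq_bot_of_head (fun h es he => ?_) (fun _ h => by cases h) H
  obtain ⟨bs, -, hb⟩ := app_eq_sym_apps he
  exact var_ne_sym_apps hb

/-- A function-headed pattern has too few arguments for any rule, so `OR` never applies to a
pattern. -/
theorem not_lt_arity {ρ : Rule S V} {us as : List (PExp S V)} (hl : us.length = ρ.args.length)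
    (hp : S.PatArity (Sum.inl ρ.fn) (us ++ as).length) : False := by
  have h1 : (us ++ as).length < S.arF ρ.fn := hp
  rw [List.length_append, hl, ρ.length_args] at h1
  omega

theorem zip_trans {es ts us : List (PExp S V)} (h1 : es.length = ts.length)
    (h2 : ts.length = us.length)
    (H1 : ∀ p ∈ es.zip ts, ∀ t, Derives P p.2 t → Derives P p.1 t)
    (H2 : ∀ p ∈ ts.zip us, Derives P p.1 p.2) : ∀ p ∈ es.zip us, Derives P p.1 p.2 := by
  intro p hp
  obtain ⟨i, hi, rfl⟩ := List.getElem_of_mem hp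
  simp only [List.length_zip] at hi
  have m1 : (es[i], ts[i]) ∈ es.zip ts := by
    rw [← List.getElem_zip (h := by simp; omega)]; exact List.getElem_mem _
  have m2 : (ts[i], us[i]) ∈ ts.zip us := by
    rw [← List.getElem_zip (h := by simp; omega)]; exact List.getElem_mem _
  rw [List.getElem_zip]
  exact H1 _ m1 _ (H2 _ m2)

theorem zip_map {es ts : List (PExp S V)} {ps : List (Exp S V)} {θ : V → PExp S V}
    (h1 : es.length = ts.length) (h2 : ts.length = ps.length)
    (H1 : ∀ p ∈ es.zip ts, ∀ t, Derives P p.2 t → Derives P p.1 t)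
    (H2 : ∀ p ∈ ts.zip ps, Derives P p.1 (p.2.toBot.subst θ)) :
    ∀ p ∈ es.zip ps, Derives P p.1 (p.2.toBot.subst θ) := by
  have := zip_trans (P := P) (us := ps.map fun q => q.toBot.subst θ) h1 (by simpa using h2) H1
    (by
      intro p hp
      rw [List.zip_map_right, List.mem_map] at hp
      obtain ⟨q, hq, rfl⟩ := hp
      exact H2 q hq)
  intro p hp
  exact this (p.1, p.2.toBot.subst θ) (by
    rw [List.zip_map_right]; exact List.mem_map_of_mem hp)

/-- The middle term is a pattern, so its own derivation cannot use `OR` and only cuts it down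
argument by argument. -/
theorem trans {e t t' : PExp S V} (H : Derives P e t) (H' : Derives P t t') :
    Derives P e t' := by
  induction H generalizing t' with
  | B e => rw [of_bot H']; exact .B _
  | RR x => exact H'
  | DC h es ts hl hd hp ih =>
    rcases sym_apps_inv H' with rfl | ⟨us, hl', hd', rfl⟩ | ⟨ρ, θ, us, as, hρ, rfl, rfl, hθ, hl', -⟩
    · exact .B _
    · exact .DC h es us (hl.trans hl') (zip_trans hl hl' (fun p hp _ => ih p hp) hd') H'.isPat
    · exact (not_lt_arity hl' (patArity_symToBot.1 (isPat_sym_apps_iff.1 hp).1)).elim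
  | OR ρ θ es as t hρ hθ hl hd hr ih ihr =>
    exact .OR ρ θ es as _ hρ hθ hl hd (ihr H')

theorem app_of_values {e₁ e₂ t₁ t₂ t : PExp S V} (H₁ : Derives P e₁ t₁) (H₂ : Derives P e₂ t₂)
    (H : Derives P (app t₁ t₂) t) : Derives P (app e₁ e₂) t := by
  induction H₁ generalizing t with
  | B e => rw [of_bot_app H]; exact .B _
  | RR x => rw [of_var_app H]; exact .B _
  | DC h es ts hl hd hp ih =>
    rw [← apps_concat] at H ⊢
    have hT : ∀ p ∈ (es ++ [e₂]).zip (ts ++ [t₂]), ∀ t, Derives P p.2 t → Derives P p.1 t := by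
      intro p hp t ht
      rw [List.zip_append hl, List.mem_append] at hp
      rcases hp with hp | hp
      · exact (hd p hp).trans ht
      · obtain rfl : p = (e₂, t₂) := by simpa using hp
        exact H₂.trans ht
    rcases sym_apps_inv H with rfl | ⟨us, hl', hd', rfl⟩ | ⟨ρ, θ, us, as, hρ, rfl, hu, hθ, hl', hd', hr⟩
    · exact .B _
    · exact .DC h _ us (by simpa [hl] using hl') (zip_trans (by simp [hl]) hl' hT hd') H.isPat
    · have h1 : ts.length < S.arF ρ.fn := (isPat_sym_apps_iff.1 hp).1
      have h2 := congrArg List.length hu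
      simp only [List.length_append, List.length_singleton, hl', ρ.length_args] at h2
      -- The value `h ts` of `e₁` is short of the arity of `h`, so one more argument can at most
      -- reach it: the rule consumes exactly `ts` and `t₂`.
      obtain rfl : as = [] := List.eq_nil_of_length_eq_zero (by omega)
      rw [List.append_nil] at hu
      rw [← List.append_nil (es ++ [e₂])]
      rw [hu] at hT
      have hlen := congrArg List.length hu
      simp only [List.length_append, List.length_singleton] at hlen
      refine .OR ρ θ _ [] t hρ hθ ?_ (zip_map ?_ hl' hT hd') hr
      · simp; omega
      · simp; omega
  | OR ρ θ es as t₁ hρ hθ hl hd hr ih ihr =>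
    rw [← apps_concat, List.append_assoc]
    refine .OR ρ θ es _ _ hρ hθ hl hd ?_
    rw [apps_concat]
    exact ihr H

/-- The intermediate values can be read off the last rule of the derivation; `OR` is the case with
content. -/
theorem app_values {e₁ e₂ t : PExp S V} (H : Derives P (app e₁ e₂) t) :
    ∃ t₁ t₂, Derives P e₁ t₁ ∧ Derives P e₂ t₂ ∧ Derives P (app t₁ t₂) t := by
  generalize he : app e₁ e₂ = e at H
  induction H generalizing e₁ with
  | B e => exact ⟨bot, bot, .B _, .B _, .B _⟩
  | RR x => exact nomatch he
  | DC h es ts hl hd hp ih =>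
    obtain ⟨es, rfl, rfl⟩ := app_eq_sym_apps he
    rcases List.eq_nil_or_concat' ts with rfl | ⟨ts, t₂, rfl⟩
    · simp at hl
    have hl' : es.length = ts.length := by simpa using hl
    rw [List.zip_append hl'] at hd
    rw [apps_concat] at hp ⊢
    exact ⟨_, t₂, .DC h es ts hl' (fun p hp => hd p (by simp [hp])) (isPat_app hp).1,
      hd (e₂, t₂) (by simp), refl hp⟩
  | OR ρ θ es as t hρ hθ hl hd hr ih ihr =>
    obtain ⟨bs, hb, rfl⟩ := app_eq_sym_apps he
    rcases List.eq_nil_or_concat' as with rfl | ⟨as, a, rfl⟩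
    -- The rule consumes `e₂` as its last argument. The value of `e₁` is then `f` applied to all
    -- instantiated parameters but the last, a pattern because one argument is missing.
    · rw [List.append_nil] at hb
      subst hb
      rcases List.eq_nil_or_concat' ρ.args with hn | ⟨ps, q, hps⟩
      · simp [hn] at hl
      have hl' : bs.length = (ps.map fun p => p.toBot.subst θ).length := by
        simpa [hps] using hl
      have hl'' : bs.length = ps.length := by simpa using hl'
      have hd1 := hd
      rw [hps, List.zip_append hl''] at hd1
      have hpat : ((sym (S.symToBot (Sum.inl ρ.fn))).apps
          (ps.map fun p => p.toBot.subst θ)).IsPat := by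
        refine .apps _ _ ?_ ?_
        · have := ρ.length_args
          rw [hps, List.length_append] at this
          change _ < S.arF ρ.fn
          simp at this ⊢
          omega
        · intro t ht
          obtain ⟨p, hp, rfl⟩ := List.mem_map.1 ht
          exact (forall_mem_zip_snd hl'' (Q := fun p => (p.toBot.subst θ).IsPat)
            (fun p hp => (hd1 p (by simp [hp])).isPat)) p hp
      refine ⟨_, q.toBot.subst θ, .DC _ bs _ hl' ?_ hpat, hd1 (e₂, q) (by simp), ?_⟩
      · intro p hp
        rw [List.zip_map_right, List.mem_map] at hp
        obtain ⟨p, hp, rfl⟩ := hp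
        exact hd1 p (by simp [hp])
      · rw [← apps_concat]
        rw [← List.append_nil (List.map _ ps ++ _)]
        refine .OR ρ θ _ [] t hρ hθ (by simp [hps]) ?_ hr
        rw [hps]
        have hm : List.map (fun p => p.toBot.subst θ) ps ++ [q.toBot.subst θ] =
          (ps ++ [q]).map fun p => p.toBot.subst θ := by simp
        rw [hm, ← hps]
        intro p hp
        have hpatall := forall_mem_zip_snd hl (Q := fun p => (p.toBot.subst θ).IsPat)
            (fun p hp => (hd p hp).isPat)
        rw [List.zip_map_left, List.mem_map] at hp
        obtain ⟨r, hr, rfl⟩ := hp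
        obtain ⟨r, hr', rfl⟩ := mem_zip_self hr
        exact refl (hpatall r hr')
    -- Here `e₂` is an extra argument, passed on to the instantiated right-hand side, so the
    -- induction hypothesis applies to the latter.
    · rw [← List.append_assoc] at hb
      obtain ⟨rfl, h2⟩ := List.append_inj' hb rfl
      obtain rfl : a = e₂ := by simpa using h2
      rw [apps_concat] at hr
      obtain ⟨t₁, t₂, h1, h2, h3⟩ := ihr (by rw [apps_concat])
      exact ⟨t₁, t₂, .OR ρ θ es as _ hρ hθ hl hd h1, h2, h3⟩

theorem app_iff {e₁ e₂ t : PExp S V} : Derives P (app e₁ e₂) t ↔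
    ∃ t₁ t₂, Derives P e₁ t₁ ∧ Derives P e₂ t₂ ∧ Derives P (app t₁ t₂) t :=
  ⟨app_values, fun ⟨_, _, h1, h2, h3⟩ => h1.app_of_values h2 h3⟩

/-- Values of a pattern arise only by replacing parts of it with `⊥`, which never produces a
variable. This recovers the matching substitution in `exists_separating`. -/
theorem isPat_to_var {x : V} {t : PExp S V} (hp : t.IsPat) (H : Derives P t (var x)) :
    t = var x := by
  cases hp with
  | var y => exact ((of_var H).resolve_left fun h => nomatch h).symm
  | apps h ts h1 h2 =>
    rcases eq_bot_or_symToBot h with rfl | ⟨g, rfl⟩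
    · obtain rfl : ts = [] := List.eq_nil_of_length_eq_zero (Nat.le_zero.1 h1)
      exact nomatch of_bot H
    · rcases sym_apps_inv H with h | ⟨us, hl', hd', h⟩ | ⟨ρ, θ, us, as, hρ, rfl, rfl, hθ, hl', -⟩
      · exact nomatch h
      · exact absurd h var_ne_sym_apps
      · exact (not_lt_arity hl' (patArity_symToBot.1 h1)).elim

theorem mono (hPP : P.rules ⊆ P'.rules) {e t : PExp S V} (H : Derives P e t) :
    Derives P' e t := by
  induction H with
  | B e => exact .B _
  | RR x => exact .RR x
  | DC h es ts hl hd hp ih => exact .DC h es ts hl ih hp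
  | OR ρ θ es as t hρ hθ hl hd hr ih ihr => exact .OR ρ θ es as t (hPP hρ) hθ hl ih ihr

/-- `A` contains everything that derivations with the old rules can produce and no function defined
by a new rule, so an expression over `A` never triggers a new rule. -/
theorem restrict {A : Set S.withBot.Sym} {P'' : Set (Rule S V)}
    (hP' : P'.rules = P.rules ∪ P'') (hbot : Sum.inr none ∈ A)
    (hA : ∀ h ∈ P.syms, S.symToBot h ∈ A) (hA' : ∀ ρ ∈ P'', S.symToBot (Sum.inl ρ.fn) ∉ A)
    {e t : PExp S V} (H : Derives P' e t) (he : e.syms ⊆ A) :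
    Derives P e t ∧ t.syms ⊆ A := by
  induction H with
  | B e => exact ⟨.B _, by simpa [bot, syms] using hbot⟩
  | RR x => exact ⟨.RR x, he⟩
  | DC h es ts hl hd hp ih =>
    have ih' : ∀ p ∈ es.zip ts, Derives P p.1 p.2 ∧ p.2.syms ⊆ A := fun p hp =>
      ih p hp fun h hh => he (mem_syms_apps.2 (Or.inr ⟨p.1, (List.of_mem_zip hp).1, hh⟩))
    refine ⟨.DC h es ts hl (fun p hp => (ih' p hp).1) hp, fun g hg => ?_⟩
    rcases mem_syms_apps.1 hg with hg | ⟨a, ha, hg⟩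
    · exact he (mem_syms_apps.2 (Or.inl hg))
    · exact forall_mem_zip_snd hl (Q := fun t => t.syms ⊆ A) (fun p hp => (ih' p hp).2) a ha hg
  | OR ρ θ es as t hρ hθ hl hd hr ih ihr =>
    have ih' : ∀ p ∈ es.zip ρ.args, Derives P p.1 (p.2.toBot.subst θ) ∧
        (p.2.toBot.subst θ).syms ⊆ A := fun p hp =>
      ih p hp fun h hh => he (mem_syms_apps.2
        (Or.inr ⟨p.1, List.mem_append_left _ (List.of_mem_zip hp).1, hh⟩))
    have hρP : ρ ∈ P.rules := by
      rw [hP'] at hρ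
      exact hρ.resolve_right fun h => hA' ρ h (he (mem_syms_apps.2 (Or.inl rfl)))
    have hr' := ihr fun g hg => by
      rcases mem_syms_apps.1 hg with hg | ⟨a, ha, hg⟩
      · rcases mem_syms_toBot_subst.1 hg with ⟨k, hk, rfl⟩ | ⟨x, hx, hg⟩
        · exact hA k ⟨ρ, hρP, Or.inr hk⟩
        -- A variable of the right-hand side occurs in some parameter, so its value is part of an
        -- argument's value, which is over `A` by induction. An extra variable could bring in any
        -- symbol.
        · have hx' := P.noExtraVars ρ hρP x hx
          rw [ρ.vars_lhs, List.mem_flatMap] at hx'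
          obtain ⟨p, hp, hxp⟩ := hx'
          exact forall_mem_zip_snd hl (Q := fun p => (p.toBot.subst θ).syms ⊆ A)
            (fun p hp => (ih' p hp).2) p hp (mem_syms_toBot_subst.2 (Or.inr ⟨x, hxp, hg⟩))
      · exact he (mem_syms_apps.2 (Or.inr ⟨a, List.mem_append_right _ ha, hg⟩))
    exact ⟨.OR ρ θ es as t hρP hθ hl (fun p hp => (ih' p hp).1) hr'.1, hr'.2⟩

end Derives

theorem mem_den {P : Program S V} {e : Exp S V} {t : PExp S V} :
    t ∈ den P e ↔ Derives P e.toBot t := ⟨fun h => h.2, fun h => ⟨h.isPat, h⟩⟩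

theorem Program.SafeExtension.derives_iff {P P' : Program S V} {e : Exp S V}
    (H : P.SafeExtension e P') {t : PExp S V} :
    Derives P' e.toBot t ↔ Derives P e.toBot t := by
  obtain ⟨P'', h1, h2⟩ := H
  refine ⟨fun h => ?_, fun h => h.mono (by rw [h1]; exact Set.subset_union_left)⟩
  refine (h.restrict (A := {h | h = Sum.inr none ∨ ∃ g, h = S.symToBot g ∧
    (g ∈ P.syms ∨ g ∈ e.syms)}) h1 (Or.inl rfl) (fun g hg => Or.inr ⟨g, rfl, Or.inl hg⟩) ?_ ?_).1
  · rintro ρ hρ (h | ⟨g, hg, hg'⟩)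
    · exact symToBot_ne_bot _ h
    · obtain rfl := symToBot_injective hg
      exact hg'.elim (h2 ρ hρ).1 (h2 ρ hρ).2
  · intro g hg
    rw [← subst_var e.toBot, mem_syms_toBot_subst] at hg
    rcases hg with ⟨k, hk, rfl⟩ | ⟨x, -, hg⟩
    · exact Or.inr ⟨k, rfl, Or.inr hk⟩
    · exact hg.elim

theorem derives_fill_iff {P : Program S V} {e e' : Exp S V}
    (H : ∀ t, Derives P e.toBot t ↔ Derives P e'.toBot t) (C : Cntxt S V) (t : PExp S V) :
    Derives P (C.fill e).toBot t ↔ Derives P (C.fill e').toBot t := by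
  induction C generalizing t with
  | hole => exact H t
  | appL C a ih => simp only [Cntxt.fill, toBot]; rw [Derives.app_iff, Derives.app_iff]; simp [ih]
  | appR a C ih => simp only [Cntxt.fill, toBot]; rw [Derives.app_iff, Derives.app_iff]; simp [ih]

/-! ### Let-expressions and their values in an environment -/

namespace LExp

theorem apps_concat (e : LExp S V) (as : List (LExp S V)) (b : LExp S V) :
    e.apps (as ++ [b]) = app (e.apps as) b := by
  simp [apps]

theorem upRen_comp (r s : ℕ → ℕ) : upRen r ∘ upRen s = upRen (r ∘ s) := by
  funext i; cases i <;> rfl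

theorem rename_rename (r s : ℕ → ℕ) (e : LExp S V) :
    (e.rename s).rename r = e.rename (r ∘ s) := by
  induction e generalizing r s with
  | fvar x => rfl
  | bvar i => rfl
  | sym h => rfl
  | app e₁ e₂ ih₁ ih₂ => simp [rename, ih₁, ih₂]
  | letin e₁ e₂ ih₁ ih₂ => simp [rename, ih₁, ih₂, upRen_comp]

theorem rename_id (e : LExp S V) : e.rename id = e := by
  have hu : upRen id = id := by funext i; cases i <;> rfl
  induction e with
  | fvar x => rfl
  | bvar i => rfl
  | sym h => rfl
  | app e₁ e₂ ih₁ ih₂ => simp [rename, ih₁, ih₂]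
  | letin e₁ e₂ ih₁ ih₂ => simp [rename, ih₁, ih₂, hu]

theorem rename_apps (r : ℕ → ℕ) (e : LExp S V) (es : List (LExp S V)) :
    (e.apps es).rename r = (e.rename r).apps (es.map (rename r)) := by
  induction es generalizing e with
  | nil => rfl
  | cons a es ih => exact ih (app e a)

theorem shiftOne_shift (e : LExp S V) : e.shift.shiftOne = e.shift.shift := by
  simp only [shift, shiftOne, rename_rename]
  rfl

theorem substB_rename (σ : ℕ → LExp S V) (r : ℕ → ℕ) (e : LExp S V) :
    (e.rename r).substB σ = e.substB (σ ∘ r) := by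
  induction e generalizing σ r with
  | fvar x => rfl
  | bvar i => rfl
  | sym h => rfl
  | app e₁ e₂ ih₁ ih₂ => simp [rename, substB, ih₁, ih₂]
  | letin e₁ e₂ ih₁ ih₂ =>
    have hu : upSub σ ∘ upRen r = upSub (σ ∘ r) := by funext i; cases i <;> rfl
    simp [rename, substB, ih₁, ih₂, hu]

theorem substB_bvar (e : LExp S V) : e.substB bvar = e := by
  have hu : upSub bvar = (bvar : ℕ → LExp S V) := by funext i; cases i <;> rfl
  induction e with
  | fvar x => rfl
  | bvar i => rfl
  | sym h => rfl
  | app e₁ e₂ ih₁ ih₂ => simp [substB, ih₁, ih₂]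
  | letin e₁ e₂ ih₁ ih₂ => simp [substB, ih₁, ih₂, hu]

theorem inst_shift (e t : LExp S V) : e.shift.inst t = e := by
  rw [inst, shift, substB_rename]
  exact substB_bvar e

theorem IsPat.rename {e : LExp S V} (H : e.IsPat) (r : ℕ → ℕ) : (e.rename r).IsPat := by
  induction H with
  | fvar x => exact .fvar x
  | bvar i => exact .bvar _
  | apps h ts h1 h2 ih =>
    rw [rename_apps]
    exact .apps _ _ (by simpa using h1) (by simpa using ih)

/-- Let-expressions without `let`. -/
def LetFree : LExp S V → Prop
  | fvar _ => True
  | bvar _ => True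
  | sym _ => True
  | app e₁ e₂ => e₁.LetFree ∧ e₂.LetFree
  | letin _ _ => False

theorem letFree_apps {e : LExp S V} {es : List (LExp S V)} :
    (e.apps es).LetFree ↔ e.LetFree ∧ ∀ a ∈ es, a.LetFree := by
  induction es generalizing e with
  | nil => simp [apps]
  | cons a es ih => exact (ih (e := app e a)).trans (by simp [LetFree, and_assoc])

theorem IsPat.letFree {e : LExp S V} (H : e.IsPat) : e.LetFree := by
  induction H with
  | fvar x => trivial
  | bvar i => trivial
  | apps h ts h1 h2 ih => exact letFree_apps.2 ⟨trivial, ih⟩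

/-- The partial expression given by a `let`-free expression in an environment for its indices. -/
def eval (η : ℕ → PExp S V) : LExp S V → PExp S V
  | fvar x => Exp.var x
  | bvar i => η i
  | sym h => Exp.sym (S.symToBot h)
  | app e₁ e₂ => Exp.app (e₁.eval η) (e₂.eval η)
  -- A dummy: `sem_iff_eval` connects `eval` with `Sem` for `LetFree` expressions only.
  | letin _ _ => Exp.bot

theorem eval_apps (η : ℕ → PExp S V) (e : LExp S V) (es : List (LExp S V)) :
    (e.apps es).eval η = (e.eval η).apps (es.map (eval η)) := by
  induction es generalizing e with
  | nil => rfl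
  | cons a es ih => exact ih (app e a)

theorem IsPat.eval {η : ℕ → PExp S V} (hη : ∀ i, (η i).IsPat) {e : LExp S V} (H : e.IsPat) :
    (e.eval η).IsPat := by
  induction H with
  | fvar x => exact .var x
  | bvar i => exact hη i
  | apps h ts h1 h2 ih =>
    rw [eval_apps]
    exact .apps _ _ (by simpa using patArity_symToBot.2 h1) (by simpa using ih)

theorem eval_rename (η : ℕ → PExp S V) (r : ℕ → ℕ) (e : LExp S V) :
    (e.rename r).eval η = e.eval (η ∘ r) := by
  induction e with
  | fvar x => rfl
  | bvar i => rfl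
  | sym h => rfl
  | app e₁ e₂ ih₁ ih₂ => simp [rename, eval, ih₁, ih₂]
  | letin e₁ e₂ ih₁ ih₂ => rfl

theorem eval_substL (η : ℕ → PExp S V) (θ : V → LExp S V) (e : Exp S V) :
    (e.substL θ).eval η = e.toBot.subst fun x => (θ x).eval η := by
  induction e with
  | var x => rfl
  | sym h => rfl
  | app e₁ e₂ ih₁ ih₂ => simp [Exp.substL, eval, Exp.toBot, Exp.subst, ih₁, ih₂]

theorem eval_toL (η : ℕ → PExp S V) (e : Exp S V) : e.toL.eval η = e.toBot :=
  (eval_substL η _ e).trans (subst_var _)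

theorem letFree_substL {θ : V → LExp S V} (hθ : ∀ x, (θ x).LetFree) (e : Exp S V) :
    (e.substL θ).LetFree := by
  induction e with
  | var x => exact hθ x
  | sym h => trivial
  | app e₁ e₂ ih₁ ih₂ => exact ⟨ih₁, ih₂⟩

/-- Extension of an environment by a value for the innermost index. -/
def consEnv (t : PExp S V) (η : ℕ → PExp S V) : ℕ → PExp S V
  | 0 => t
  | i + 1 => η i

theorem isPat_consEnv {t : PExp S V} {η : ℕ → PExp S V} (ht : t.IsPat) (hη : ∀ i, (η i).IsPat) :
    ∀ i, (consEnv t η i).IsPat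
  | 0 => ht
  | i + 1 => hη i

/-- The values of a let-expression in an environment for its indices. -/
def Sem (P : Program S V) : LExp S V → (ℕ → PExp S V) → PExp S V → Prop
  | fvar x, _, t => Derives P (Exp.var x) t
  | bvar i, η, t => Derives P (η i) t
  | sym h, _, t => Derives P (Exp.sym (S.symToBot h)) t
  | app e₁ e₂, η, t => ∃ t₁ t₂, Sem P e₁ η t₁ ∧ Sem P e₂ η t₂ ∧ Derives P (Exp.app t₁ t₂) t
  -- Call-time choice: a single value of `e₁` serves all occurrences of the bound variable.
  | letin e₁ e₂, η, t => ∃ t₁, Sem P e₁ η t₁ ∧ Sem P e₂ (consEnv t₁ η) t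

variable {P : Program S V}

theorem sem_bot (e : LExp S V) (η : ℕ → PExp S V) : Sem P e η bot := by
  induction e generalizing η with
  | fvar x => exact .B _
  | bvar i => exact .B _
  | sym h => exact .B _
  | app e₁ e₂ ih₁ ih₂ => exact ⟨_, _, ih₁ η, ih₂ η, .B _⟩
  | letin e₁ e₂ ih₁ ih₂ => exact ⟨_, ih₁ η, ih₂ _⟩

theorem Sem.isPat {e : LExp S V} {η : ℕ → PExp S V} {t : PExp S V} (H : Sem P e η t) :
    t.IsPat := by
  induction e generalizing η with
  | fvar x => exact Derives.isPat H
  | bvar i => exact Derives.isPat H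
  | sym h => exact Derives.isPat H
  | app e₁ e₂ ih₁ ih₂ => obtain ⟨_, _, _, _, h⟩ := H; exact h.isPat
  | letin e₁ e₂ ih₁ ih₂ => obtain ⟨_, _, h⟩ := H; exact ih₂ h

theorem sem_iff_eval {e : LExp S V} (he : e.LetFree) {η : ℕ → PExp S V} {t : PExp S V} :
    Sem P e η t ↔ Derives P (e.eval η) t := by
  induction e generalizing t with
  | fvar x => exact Iff.rfl
  | bvar i => exact Iff.rfl
  | sym h => exact Iff.rfl
  | app e₁ e₂ ih₁ ih₂ =>
    simp only [Sem, eval]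
    rw [Derives.app_iff]
    simp only [ih₁ he.1, ih₂ he.2]
  | letin e₁ e₂ ih₁ ih₂ => exact he.elim

theorem sem_rename {r : ℕ → ℕ} {e : LExp S V} {η : ℕ → PExp S V} {t : PExp S V} :
    Sem P (e.rename r) η t ↔ Sem P e (η ∘ r) t := by
  induction e generalizing r η t with
  | fvar x => exact Iff.rfl
  | bvar i => exact Iff.rfl
  | sym h => exact Iff.rfl
  | app e₁ e₂ ih₁ ih₂ => simp only [rename, Sem, ih₁, ih₂]
  | letin e₁ e₂ ih₁ ih₂ =>
    have hu (t₁ : PExp S V) : consEnv t₁ η ∘ upRen r = consEnv t₁ (η ∘ r) := by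
      funext i; cases i <;> rfl
    simp only [rename, Sem, ih₁, ih₂, hu]

theorem sem_shift {e : LExp S V} {η : ℕ → PExp S V} {t₁ t : PExp S V} :
    Sem P e.shift (consEnv t₁ η) t ↔ Sem P e η t := sem_rename

/-- The values of an index are those derivable from its entry in the environment, and for a let-free
term these are the values of its `eval`. -/
theorem sem_substB {σ : ℕ → LExp S V} (hσ : ∀ i, (σ i).IsPat) {e : LExp S V}
    {η : ℕ → PExp S V} {t : PExp S V} :
    Sem P (e.substB σ) η t ↔ Sem P e (fun i => (σ i).eval η) t := by
  induction e generalizing σ η t with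
  | fvar x => exact Iff.rfl
  | bvar i => exact sem_iff_eval (hσ i).letFree
  | sym h => exact Iff.rfl
  | app e₁ e₂ ih₁ ih₂ => simp only [substB, Sem, ih₁ hσ, ih₂ hσ]
  | letin e₁ e₂ ih₁ ih₂ =>
    have hu (t₁ : PExp S V) : (fun i => (upSub σ i).eval (consEnv t₁ η)) =
        consEnv t₁ fun i => (σ i).eval η := by
      funext i
      cases i with
      | zero => rfl
      | succ i => exact eval_rename _ _ _
    have hσ' : ∀ i, (upSub σ i).IsPat := by
      intro i
      cases i with
      | zero => exact .bvar 0
      | succ i => exact (hσ i).rename _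
    simp only [substB, Sem, ih₁ hσ, ih₂ hσ', hu]

end LExp

/-! ### Soundness of HOlet-rewriting -/

open LExp

theorem Exp.substL_apps (θ : V → LExp S V) (e : Exp S V) (es : List (Exp S V)) :
    (e.apps es).substL θ = (e.substL θ).apps (es.map (substL θ)) := by
  induction es generalizing e with
  | nil => rfl
  | cons a es ih => exact ih (app e a)

theorem Exp.IsPat.substL {e : Exp S V} (H : e.IsPat) {θ : V → LExp S V}
    (hθ : ∀ x, (θ x).IsPat) : (e.substL θ).IsPat := by
  induction H with
  | var x => exact hθ x
  | apps h ts h1 h2 ih =>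
    rw [substL_apps]
    exact .apps _ _ (by simpa using h1) (by simpa using ih)

/-- A rewriting step does not create values. -/
theorem LetStep.sem_subset {P : Program S V} {e e' : LExp S V} (H : LetStep P e e')
    {η : ℕ → PExp S V} (hη : ∀ i, (η i).IsPat) {t : PExp S V} (h : Sem P e' η t) :
    Sem P e η t := by
  induction H generalizing η t with
  | Fapp ρ θ hρ hθ =>
    have hlf := letFree_substL fun x => (hθ x).letFree
    rw [sem_iff_eval (hlf _), eval_substL] at h ⊢
    rw [Rule.lhs, toBot_apps, subst_apps]
    rw [← List.append_nil (List.map _ (List.map _ _))]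
    have hθ' : ∀ x, ((θ x).eval η).IsPat := fun x => (hθ x).eval hη
    -- The substitution is `θ` evaluated in `η`; the instantiated parameters are patterns and derive
    -- themselves.
    refine .OR ρ _ _ [] t hρ hθ' (by simp) ?_ h
    intro p hp
    rw [List.zip_map_left, List.mem_map] at hp
    obtain ⟨q, hq, rfl⟩ := hp
    rw [List.zip_map_left, List.mem_map] at hq
    obtain ⟨q, hq, rfl⟩ := hq
    obtain ⟨a, ha, rfl⟩ := mem_zip_self hq
    have := (((ρ.isPat_args a ha).substL hθ).eval hη)
    rw [eval_substL] at this
    exact Derives.refl this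
  | LetIn e₁ e₂ hs =>
    obtain ⟨t₂, h₂, t₁, t₂', h₁, h₂', h⟩ := h
    exact ⟨t₁, t₂, sem_shift.1 h₁, h₂, (Derives.refl h₁.isPat).app_of_values h₂' h⟩
  | Bind p e hp =>
    rw [inst, sem_substB (fun i => by cases i with | zero => exact hp | succ i => exact .bvar i)] at h
    -- A pattern is its own best value, so sharing that value loses nothing.
    refine ⟨p.eval η, (sem_iff_eval hp.letFree).2 (Derives.refl (hp.eval hη)), ?_⟩
    convert h using 1
    funext i
    cases i <;> rfl
  | Elim e₁ e₂ => exact ⟨bot, sem_bot _ _, sem_shift.2 h⟩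
  | Flat e₁ e₂ e₃ =>
    obtain ⟨t₁, h₁, t₂, h₂, h₃⟩ := h
    refine ⟨t₂, ⟨t₁, h₁, h₂⟩, ?_⟩
    rw [shiftOne, sem_rename] at h₃
    convert h₃ using 1
    funext i
    cases i <;> rfl
  | LetAp e₁ e₂ e₃ =>
    obtain ⟨t₁, h₁, t₂, t₃, h₂, h₃, h⟩ := h
    exact ⟨t₂, t₃, ⟨t₁, h₁, h₂⟩, sem_shift.1 h₃, h⟩
  | appL e e' a hs ih =>
    obtain ⟨t₁, t₂, h₁, h₂, h⟩ := h
    exact ⟨t₁, t₂, ih hη h₁, h₂, h⟩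
  | appR a e e' hs ih =>
    obtain ⟨t₁, t₂, h₁, h₂, h⟩ := h
    exact ⟨t₁, t₂, h₁, ih hη h₂, h⟩
  | letL e e' a hs ih =>
    obtain ⟨t₁, h₁, h⟩ := h
    exact ⟨t₁, ih hη h₁, h⟩
  | letR a e e' hs ih =>
    obtain ⟨t₁, h₁, h⟩ := h
    exact ⟨t₁, h₁, ih (isPat_consEnv h₁.isPat hη) h⟩

theorem LetRewrites.derives {P : Program S V} {e t : Exp S V} (ht : t.IsPat)
    (H : LetRewrites P e t) : Derives P e.toBot t.toBot := by
  -- The environment does not matter at the endpoints `e.toL` and `t.toL`, which contain no indices;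
  -- `⊥` is a convenient pattern.
  have key : ∀ {a b : LExp S V}, Relation.ReflTransGen (LetStep P) a b → ∀ s,
      Sem P b (fun _ => bot) s → Sem P a (fun _ => bot) s := by
    intro a b hab s hs
    induction hab with
    | refl => exact hs
    | tail _ hstep ih => exact ih (hstep.sem_subset (fun _ => isPat_bot) hs)
  have hlf (e : Exp S V) : e.toL.LetFree := letFree_substL (θ := LExp.fvar) (fun _ => trivial) e
  have := key H t.toBot ((sem_iff_eval (hlf t)).2 (by
    rw [eval_toL]; exact Derives.refl (toBot_isPat ht)))
  rwa [sem_iff_eval (hlf e), eval_toL] at this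

/-! ### Completeness of HOlet-rewriting: covers and matching -/

/-- `Cover e a`: the let-expression `a` arises from the partial expression `e` by replacing
occurrences of `⊥` by arbitrary let-expressions. -/
inductive Cover : PExp S V → LExp S V → Prop
  | bot (a : LExp S V) : Cover Exp.bot a
  | var (x : V) : Cover (Exp.var x) (LExp.fvar x)
  | sym (h : S.Sym) : Cover (Exp.sym (S.symToBot h)) (LExp.sym h)
  | app {e₁ e₂ : PExp S V} {a₁ a₂ : LExp S V} :
      Cover e₁ a₁ → Cover e₂ a₂ → Cover (Exp.app e₁ e₂) (LExp.app a₁ a₂)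

namespace Cover

theorem rename {e : PExp S V} {a : LExp S V} (H : Cover e a) (r : ℕ → ℕ) :
    Cover e (a.rename r) := by
  induction H with
  | bot a => exact .bot _
  | var x => exact .var x
  | sym h => exact .sym h
  | app h₁ h₂ ih₁ ih₂ => exact .app ih₁ ih₂

theorem apps {e : PExp S V} {a : LExp S V} {es : List (PExp S V)} {as : List (LExp S V)}
    (H : Cover e a) (Hs : List.Forall₂ Cover es as) : Cover (e.apps es) (a.apps as) := by
  induction Hs generalizing e a with
  | nil => exact H
  | cons h hs ih => exact ih (.app H h)

theorem sym_inv {h : S.Sym} {a : LExp S V}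
    (H : Cover (Exp.sym (S.symToBot h) : PExp S V) a) : a = LExp.sym h := by
  generalize he : (Exp.sym (S.symToBot h) : PExp S V) = e at H
  cases H with
  | bot a => exact absurd he (sym_apps_ne_bot (es := []))
  | var x => exact nomatch he
  | sym g =>
    injection he with he
    rw [symToBot_injective he]
  | app h₁ h₂ => exact nomatch he

theorem app_inv {e₁ e₂ : PExp S V} {a : LExp S V} (H : Cover (Exp.app e₁ e₂) a) :
    ∃ a₁ a₂, a = LExp.app a₁ a₂ ∧ Cover e₁ a₁ ∧ Cover e₂ a₂ := by
  generalize he : Exp.app e₁ e₂ = e at H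
  cases H with
  | bot a => exact absurd he (by intro h; cases h)
  | var x => exact nomatch he
  | sym g => exact nomatch he
  | app h₁ h₂ =>
    injection he with he₁ he₂
    subst he₁ he₂
    exact ⟨_, _, rfl, h₁, h₂⟩

theorem apps_inv {e : PExp S V} {es : List (PExp S V)} {a : LExp S V}
    (H : Cover (e.apps es) a) :
    ∃ b as, a = b.apps as ∧ Cover e b ∧ List.Forall₂ Cover es as := by
  induction es generalizing e with
  | nil => exact ⟨a, [], rfl, H, .nil⟩
  | cons c es ih =>
    obtain ⟨b, as, rfl, hb, has⟩ := ih (e := Exp.app e c) H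
    obtain ⟨b₁, b₂, rfl, h₁, h₂⟩ := hb.app_inv
    exact ⟨b₁, b₂ :: as, rfl, h₁, .cons h₂ has⟩

theorem sym_apps_inv {h : S.Sym} {es : List (PExp S V)} {a : LExp S V}
    (H : Cover ((Exp.sym (S.symToBot h)).apps es) a) :
    ∃ as, a = (LExp.sym h).apps as ∧ List.Forall₂ Cover es as := by
  obtain ⟨b, as, rfl, hb, has⟩ := H.apps_inv
  exact ⟨as, by rw [hb.sym_inv], has⟩

theorem toL (e : Exp S V) : Cover e.toBot e.toL := by
  induction e with
  | var x => exact .var x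
  | sym h => exact .sym h
  | app e₁ e₂ ih₁ ih₂ => exact .app ih₁ ih₂

theorem eq_toL {e : Exp S V} {a : LExp S V} (H : Cover e.toBot a) : a = e.toL := by
  induction e generalizing a with
  | var x =>
    generalize he : (Exp.var x : Exp S V).toBot = e at H
    cases H with
    | bot a => exact absurd he (by intro h; cases h)
    | var y => cases he; rfl
    | sym g => exact nomatch he
    | app h₁ h₂ => exact nomatch he
  | sym h => exact H.sym_inv
  | app e₁ e₂ ih₁ ih₂ =>
    obtain ⟨a₁, a₂, rfl, h₁, h₂⟩ := H.app_inv
    rw [ih₁ h₁, ih₂ h₂]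
    rfl

theorem subst {θ : V → PExp S V} {σ : V → LExp S V} {e : Exp S V}
    (H : ∀ x ∈ e.vars, Cover (θ x) (σ x)) : Cover (e.toBot.subst θ) (e.substL σ) := by
  induction e with
  | var x => exact H x (by simp [vars])
  | sym h => exact .sym h
  | app e₁ e₂ ih₁ ih₂ =>
    exact .app (ih₁ fun x hx => H x (by simp [vars, hx]))
      (ih₂ fun x hx => H x (by simp [vars, hx]))

end Cover

theorem Exp.subst_congrL {σ τ : V → LExp S V} {e : Exp S V} (H : ∀ x ∈ e.vars, σ x = τ x) :
    e.substL σ = e.substL τ := by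
  induction e with
  | var x => exact H x (by simp [vars])
  | sym h => rfl
  | app e₁ e₂ ih₁ ih₂ =>
    simp only [Exp.substL]
    rw [ih₁ fun x hx => H x (by simp [vars, hx]), ih₂ fun x hx => H x (by simp [vars, hx])]

/-- Matching against a linear expression. -/
theorem exists_matching {θ : V → PExp S V} {p : Exp S V} {a : LExp S V} (hp : p.vars.Nodup)
    (H : Cover (p.toBot.subst θ) a) :
    ∃ σ : V → LExp S V, a = p.substL σ ∧ ∀ x ∈ p.vars, Cover (θ x) (σ x) := by
  induction p generalizing a with
  | var x => exact ⟨fun _ => a, rfl, fun y hy => by rw [List.mem_singleton.1 hy]; exact H⟩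
  | sym h => exact ⟨LExp.fvar, H.sym_inv, by simp [vars]⟩
  | app p₁ p₂ ih₁ ih₂ =>
    classical
    obtain ⟨a₁, a₂, rfl, h₁, h₂⟩ := H.app_inv
    obtain ⟨n₁, n₂, hd⟩ := List.nodup_append.1 hp
    obtain ⟨σ₁, rfl, hσ₁⟩ := ih₁ n₁ h₁
    obtain ⟨σ₂, rfl, hσ₂⟩ := ih₂ n₂ h₂
    have hne : ∀ x ∈ p₂.vars, x ∉ p₁.vars := fun x h2 h1 => hd x h1 x h2 rfl
    -- By linearity the two halves share no variable, so their matchers glue.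
    refine ⟨fun x => if x ∈ p₁.vars then σ₁ x else σ₂ x, ?_, ?_⟩
    · simp only [Exp.substL]
      congr 1
      · exact subst_congrL fun x hx => by simp [hx]
      · exact subst_congrL fun x hx => by simp [hne x hx]
    · intro x hx
      simp only [vars, List.mem_append] at hx
      by_cases h : x ∈ p₁.vars
      · simpa [h] using hσ₁ x h
      · simpa [h] using hσ₂ x (hx.resolve_left h)

theorem LExp.sym_apps_inj {h h' : S.Sym} {as bs : List (LExp S V)}
    (H : (LExp.sym h).apps as = (LExp.sym h').apps bs) : h = h' ∧ as = bs := by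
  induction as using List.reverseRecOn generalizing bs with
  | nil =>
    rcases List.eq_nil_or_concat' bs with rfl | ⟨bs, b, rfl⟩
    · exact ⟨by injection H, rfl⟩
    · rw [LExp.apps_concat] at H; exact nomatch H
  | append_singleton as a ih =>
    rcases List.eq_nil_or_concat' bs with rfl | ⟨bs, b, rfl⟩
    · rw [LExp.apps_concat] at H; exact nomatch H
    · rw [LExp.apps_concat, LExp.apps_concat] at H
      injection H with H1 H2
      obtain ⟨rfl, rfl⟩ := ih H1
      exact ⟨rfl, by rw [H2]⟩

theorem LExp.isPat_sym_apps {h : S.Sym} {ts : List (LExp S V)}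
    (H : ((LExp.sym h).apps ts).IsPat) : ∀ t ∈ ts, t.IsPat := by
  generalize he : (LExp.sym h).apps ts = e at H
  have aux {a : LExp S V} (ha : ∀ b c, a ≠ .app b c) (ha' : ∀ h, a ≠ .sym h) :
      (LExp.sym h).apps ts ≠ a := by
    rcases List.eq_nil_or_concat' ts with rfl | ⟨bs, b, rfl⟩
    · exact (ha' h).symm
    · rw [LExp.apps_concat]; exact (ha _ _).symm
  cases H with
  | fvar x => exact absurd he (aux (fun _ _ h => nomatch h) (fun _ h => nomatch h))
  | bvar i => exact absurd he (aux (fun _ _ h => nomatch h) (fun _ h => nomatch h))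
  | apps h' ts' h1 h2 =>
    obtain ⟨rfl, rfl⟩ := sym_apps_inj he
    exact h2

/-- Each such value is a subterm of a pattern. This makes the matcher a pattern substitution on the
rule's variables, as `Fapp` demands. -/
theorem isPat_of_substL {σ : V → LExp S V} {p : Exp S V} (hp : p.IsPat)
    (H : (p.substL σ).IsPat) : ∀ x ∈ p.vars, (σ x).IsPat := by
  induction hp with
  | var y => intro x hx; rw [List.mem_singleton.1 hx]; exact H
  | apps h ts h1 h2 ih =>
    rw [substL_apps] at H
    have := isPat_sym_apps H
    intro x hx
    simp only [vars_apps, vars, List.nil_append, List.mem_flatMap] at hx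
    obtain ⟨t, ht, hx⟩ := hx
    exact ih t ht (this _ (List.mem_map_of_mem ht)) x hx

theorem shift_toL (e : Exp S V) : e.toL.shift = e.toL := by
  induction e with
  | var x => rfl
  | sym h => rfl
  | app e₁ e₂ ih₁ ih₂ => exact congrArg₂ LExp.app ih₁ ih₂

theorem forall₂_concat_left {α β : Type*} {R : α → β → Prop} {as : List α} {a : α} {l : List β}
    (H : List.Forall₂ R (as ++ [a]) l) :
    ∃ bs b, l = bs ++ [b] ∧ List.Forall₂ R as bs ∧ R a b := by
  induction as generalizing l with
  | nil =>
    cases H with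
    | cons h hs => cases hs; exact ⟨[], _, rfl, .nil, h⟩
  | cons c as ih =>
    cases H with
    | cons h hs =>
      obtain ⟨bs, b, rfl, h1, h2⟩ := ih hs
      exact ⟨_ :: bs, b, rfl, .cons h h1, h2⟩

theorem forall₂_concat {α β : Type*} {R : α → β → Prop} {as : List α} {a : α} {bs : List β}
    {b : β} (H : List.Forall₂ R as bs) (h : R a b) :
    List.Forall₂ R (as ++ [a]) (bs ++ [b]) := by
  induction H with
  | nil => exact .cons h .nil
  | cons h' _ ih => exact .cons h' ih

theorem forall₂_of_zip {α β γ : Type*} {R : α → γ → Prop} {T : β → γ → Prop} {as : List α}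
    {bs : List β} {cs : List γ} (hl : as.length = bs.length)
    (hz : ∀ p ∈ as.zip bs, ∀ c, R p.1 c → T p.2 c) (H : List.Forall₂ R as cs) :
    List.Forall₂ T bs cs := by
  induction H generalizing bs with
  | nil => rw [List.eq_nil_of_length_eq_zero hl.symm]; exact .nil
  | cons h _ ih =>
    rcases bs with _ | ⟨b, bs⟩
    · simp at hl
    · exact .cons (hz (_, b) (by simp) _ h) (ih (by simpa using hl) fun p hp => hz p (by simp [hp]))

theorem LetStep.apps {P : Program S V} {a b : LExp S V} (H : LetStep P a b)
    (cs : List (LExp S V)) : LetStep P (a.apps cs) (b.apps cs) := by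
  induction cs generalizing a b with
  | nil => exact H
  | cons c cs ih => exact ih (.appL _ _ _ H)

/-! ### Completeness of HOlet-rewriting: floating bindings and simulation -/

/-- `Ev P Q a`: `a` rewrites to a sequence of bindings around a body in `Q`. -/
inductive Ev (P : Program S V) (Q : LExp S V → Prop) : LExp S V → Prop
  | done {a : LExp S V} : Q a → Ev P Q a
  | step {a b : LExp S V} : LetStep P a b → Ev P Q b → Ev P Q a
  | bind {a b : LExp S V} : Ev P Q b → Ev P Q (LExp.letin a b)

namespace Ev

variable {P : Program S V}

theorem rewrites {t : Exp S V} {a : LExp S V} (H : Ev P (· = t.toL) a) :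
    Relation.ReflTransGen (LetStep P) a t.toL := by
  induction H with
  | done h => rw [h]
  | step h _ ih => exact .head h ih
  | @bind a b _ ih =>
    -- The body has become `t.toL`, which mentions no index, so `Elim` drops the binding.
    refine .tail (b := LExp.letin a t.toL) (ih.lift (LExp.letin a) fun _ _ h => .letR _ _ _ h) ?_
    conv => enter [2, 2]; rw [← shift_toL t]
    exact .Elim _ _

theorem mono {Q Q' : LExp S V → Prop} {a : LExp S V} (H : ∀ p, Q p → Ev P Q' p)
    (ha : Ev P Q a) : Ev P Q' a := by
  induction ha with
  | done h => exact H _ h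
  | step h _ ih => exact .step h ih
  | bind _ ih => exact .bind ih

/-- `LetAp` floats the bindings out of the function position; each one shifts the argument, hence
the closure of `R` under renaming. -/
theorem app_left {Q Q' R : LExp S V → Prop} (hR : ∀ c r, R c → R (c.rename r))
    (H : ∀ p c, Q p → R c → Ev P Q' (.app p c)) {a c : LExp S V} (ha : Ev P Q a) (hc : R c) :
    Ev P Q' (.app a c) := by
  induction ha generalizing c with
  | done h => exact H _ _ h hc
  | step h _ ih => exact .step (.appL _ _ _ h) (ih hc)
  | bind _ ih => exact .step (.LetAp _ _ _) (.bind (ih (hR _ _ hc)))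

theorem apps_left {Q Q' : LExp S V → Prop} {es : List (PExp S V)}
    (H : ∀ p cs, Q p → List.Forall₂ Cover es cs → Ev P Q' (p.apps cs)) {a : LExp S V}
    {cs : List (LExp S V)} (ha : Ev P Q a) (hc : List.Forall₂ Cover es cs) :
    Ev P Q' (a.apps cs) := by
  induction es using List.reverseRecOn generalizing Q' cs with
  | nil => cases hc; exact ha.mono fun p hp => H p [] hp .nil
  | append_singleton es e ih =>
    obtain ⟨cs, c, rfl, hcs, hc⟩ := forall₂_concat_left hc
    rw [LExp.apps_concat]
    refine app_left (Q := fun p => ∃ q ds, Q q ∧ List.Forall₂ Cover es ds ∧ p = q.apps ds)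
      (R := Cover e) (fun c r h => h.rename r) ?_
      (ih (fun p cs hp hcs => .done ⟨p, cs, hp, hcs, rfl⟩) hcs) hc
    rintro _ c ⟨p, ds, hp, hds, rfl⟩ hc
    rw [← LExp.apps_concat]
    exact H p _ hp (forall₂_concat hds hc)

theorem letin_left {Q Q' R : LExp S V → Prop} (hR : ∀ c, R c → R c.shiftOne)
    (H : ∀ p c, Q p → R c → Ev P Q' (.letin p c)) {a c : LExp S V} (ha : Ev P Q a) (hc : R c) :
    Ev P Q' (.letin a c) := by
  induction ha generalizing c with
  | done h => exact H _ _ h hc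
  | step h _ ih => exact .step (.letL _ _ _ h) (ih hc)
  | bind _ ih => exact .step (.Flat _ _ _) (.bind (ih (hR _ hc)))

/-- No single rule floats a binding out of an argument. Instead `LetIn` names the argument, `Flat`
pulls its bindings out, and `Bind` puts the remaining body back, which must therefore be a pattern.
-/
theorem app_right {Q Q' R : LExp S V → Prop} (hR : ∀ c r, R c → R (c.rename r))
    (hQ : ∀ p, Q p → p.IsPat) (H : ∀ b p, R b → Q p → Ev P Q' (.app b p)) {a b : LExp S V}
    (ha : Ev P Q a) (hb : R b) : Ev P Q' (.app b a) := by
  induction ha with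
  | done h => exact H _ _ hb h
  | step h _ ih => exact .step (.appR _ _ _ h) ih
  | bind ha' ih =>
    refine .step (.LetIn _ _ (.letin _ _)) ?_
    refine letin_left (Q := Q) (R := fun c => ∃ b, R b ∧ c = .app b.shift (.bvar 0))
      ?_ ?_ (.bind ha') ⟨b, hb, rfl⟩
    · rintro _ ⟨b, hb, rfl⟩
      refine ⟨b.shift, hR _ _ hb, ?_⟩
      rw [← shiftOne_shift]
      rfl
    · rintro p _ hp ⟨b, hb, rfl⟩
      refine .step (.Bind _ _ (hQ p hp)) ?_
      have : (LExp.app b.shift (.bvar 0)).inst p = .app b p :=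
        congrArg (fun x => LExp.app x p) (inst_shift b p)
      rw [this]
      exact H _ _ hb hp

end Ev

/-- The argument `a` of an application can be replaced by a pattern that covers `t`. -/
def ArgEv (P : Program S V) (t : PExp S V) (a : LExp S V) : Prop :=
  ∀ R Q' : LExp S V → Prop, (∀ c r, R c → R (c.rename r)) →
    (∀ b p, R b → p.IsPat → Cover t p → Ev P Q' (.app b p)) → ∀ b, R b → Ev P Q' (.app b a)

variable {P : Program S V}

theorem ArgEv.of_ev {t : PExp S V} {a : LExp S V} (H : Ev P (fun p => p.IsPat ∧ Cover t p) a) :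
    ArgEv P t a := fun _ _ hR h _ hb =>
  Ev.app_right hR (fun _ hp => hp.1) (fun b p hb hp => h b p hb hp.1 hp.2) H hb

/-- An argument whose value is not needed stays in a binding; its index takes its place and covers
`⊥`. -/
theorem ArgEv.of_shareable {a : LExp S V} (H : a.Shareable) : ArgEv P bot a :=
  fun _ _ hR h _ hb => .step (.LetIn _ _ H) (.bind (h _ _ (hR _ _ hb) (.bvar 0) (.bot _)))

theorem ArgEv.step {t : PExp S V} {a b : LExp S V} (h : LetStep P a b) (H : ArgEv P t b) :
    ArgEv P t a :=
  fun R Q' hR hQ c hc => .step (.appR _ _ _ h) (H R Q' hR hQ c hc)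

theorem ArgEv.letin_apps (e₁ e₂ : LExp S V) (as : List (LExp S V)) :
    ArgEv P bot ((LExp.letin e₁ e₂).apps as) := by
  induction as generalizing e₂ with
  | nil => exact .of_shareable (.letin _ _)
  | cons a as ih => exact .step (LetStep.apps (.LetAp _ _ _) as) (ih _)

theorem LExp.head_cases (a : LExp S V) :
    (∃ e₁ e₂ as, a = (LExp.letin e₁ e₂).apps as) ∨ (∃ x as, a = (LExp.fvar x).apps as) ∨
      (∃ i as, a = (LExp.bvar i).apps as) ∨ ∃ h as, a = (LExp.sym h).apps as := by
  induction a with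
  | fvar x => exact Or.inr (Or.inl ⟨x, [], rfl⟩)
  | bvar x => exact Or.inr (Or.inr (Or.inl ⟨x, [], rfl⟩))
  | sym x => exact Or.inr (Or.inr (Or.inr ⟨x, [], rfl⟩))
  | letin e₁ e₂ _ _ => exact Or.inl ⟨e₁, e₂, [], rfl⟩
  | app e₁ e₂ ih _ =>
    rcases ih with ⟨b, c, as, rfl⟩ | ⟨x, as, rfl⟩ | ⟨x, as, rfl⟩ | ⟨x, as, rfl⟩
    · exact Or.inl ⟨b, c, as ++ [e₂], by rw [apps_concat]⟩
    · exact Or.inr (Or.inl ⟨x, as ++ [e₂], by rw [apps_concat]⟩)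
    · exact Or.inr (Or.inr (Or.inl ⟨x, as ++ [e₂], by rw [apps_concat]⟩))
    · exact Or.inr (Or.inr (Or.inr ⟨x, as ++ [e₂], by rw [apps_concat]⟩))

/-- Bindings floated out of one argument shift the others. Arguments still to be treated are
therefore assumed good under every renaming, while patterns already reached stay patterns with the
same cover. -/
theorem Ev.sym_apps (h : S.Sym) {ts : List (PExp S V)} {cs : List (LExp S V)}
    (H : List.Forall₂ (fun t c => ∀ r, ArgEv P t (c.rename r)) ts cs) :
    Ev P (fun p => ∃ ps, p = (LExp.sym h).apps ps ∧
      List.Forall₂ (fun t p => p.IsPat ∧ Cover t p) ts ps) ((LExp.sym h).apps cs) := by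
  induction ts using List.reverseRecOn generalizing cs with
  | nil => cases H; exact .done ⟨[], rfl, .nil⟩
  | append_singleton ts t ih =>
    obtain ⟨cs, c, rfl, hcs, hc⟩ := forall₂_concat_left H
    rw [LExp.apps_concat]
    refine Ev.app_left (R := fun c => ∀ r, ArgEv P t (c.rename r))
      (fun c r hc s => by rw [rename_rename]; exact hc _) ?_ (ih hcs) hc
    rintro _ c ⟨ps, rfl, hps⟩ hc
    have hc' := hc id
    rw [rename_id] at hc'
    refine hc' (fun p => ∃ ps, p = (LExp.sym h).apps ps ∧
      List.Forall₂ (fun t p => p.IsPat ∧ Cover t p) ts ps) _ ?_ ?_ _ ⟨ps, rfl, hps⟩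
    · rintro _ r ⟨ps, rfl, hps⟩
      refine ⟨ps.map (LExp.rename r), rename_apps _ _ _, ?_⟩
      rw [List.forall₂_map_right_iff]
      exact hps.imp fun _ _ h => ⟨h.1.rename r, h.2.rename r⟩
    · rintro _ p ⟨ps, rfl, hps⟩ hp hpt
      exact .done ⟨ps ++ [p], (LExp.apps_concat _ _ _).symm, forall₂_concat hps ⟨hp, hpt⟩⟩

theorem forall₂_isPat {ts : List (PExp S V)} {ps : List (LExp S V)}
    (H : List.Forall₂ (fun t p => p.IsPat ∧ Cover t p) ts ps) :
    ts.length = ps.length ∧ (∀ p ∈ ps, p.IsPat) ∧ List.Forall₂ Cover ts ps := by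
  refine ⟨H.length_eq, ?_, H.imp fun _ _ h => h.2⟩
  induction H with
  | nil => simp
  | cons h _ ih => simpa using ⟨h.1, ih⟩

/-- `Fapp` wants patterns even for arguments whose value is `⊥`. By the head of `a`: a `let` is
moved to the root and shared, a bare variable is a pattern, an applied variable or a symbol with too
many arguments for a pattern is shared, and otherwise it suffices to treat the arguments. -/
theorem ArgEv.bot_of_args (a : LExp S V)
    (hargs : ∀ h as, a = (LExp.sym h).apps as → ∀ c ∈ as, ∀ r, ArgEv P Exp.bot (c.rename r))
    (r : ℕ → ℕ) : ArgEv P Exp.bot (a.rename r) := by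
  rcases a.head_cases with ⟨b, c, as, rfl⟩ | ⟨x, as, rfl⟩ | ⟨x, as, rfl⟩ | ⟨h, as, rfl⟩ <;>
    rw [rename_apps]
  · exact .letin_apps _ _ _
  · by_cases has : as = []
    · subst has
      exact .of_ev (.done ⟨.fvar x, .bot _⟩)
    · exact .of_shareable (.fvarApp _ _ (by simpa using has))
  · by_cases has : as = []
    · subst has
      exact .of_ev (.done ⟨.bvar _, .bot _⟩)
    · exact .of_shareable (.bvarApp _ _ (by simpa using has))
  · by_cases hpa : S.PatArity h as.length
    · have hf : List.Forall₂ (fun t c => ∀ s, ArgEv P t (LExp.rename s c))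
          (as.map fun _ => Exp.bot) (as.map (LExp.rename r)) := by
        rw [List.forall₂_map_left_iff, List.forall₂_map_right_iff, List.forall₂_same]
        intro c hc s
        rw [rename_rename]
        exact hargs h as rfl c hc _
      refine .of_ev ((Ev.sym_apps h hf).mono ?_)
      rintro _ ⟨ps, rfl, hps⟩
      obtain ⟨hl, hp, -⟩ := forall₂_isPat hps
      rw [List.length_map] at hl
      exact .done ⟨.apps _ _ (hl ▸ hpa) hp, .bot _⟩
    · rcases h with f | c
      · exact .of_shareable (.active _ _ (by simpa [Signature.PatArity] using hpa))
      · exact .of_shareable (.junk _ _ (by simpa [Signature.PatArity] using hpa))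

theorem ArgEv.bot (a : LExp S V) : ArgEv P Exp.bot a := by
  -- Structural induction passes along the spine: the arguments of `e₁ e₂` are those of `e₁`
  -- together with `e₂`.
  suffices H : ∀ h as, a = (LExp.sym h).apps as → ∀ c ∈ as, ∀ r, ArgEv P Exp.bot (c.rename r) by
    simpa [rename_id] using bot_of_args a H id
  induction a with
  | sym g =>
    intro h as ha
    obtain ⟨-, rfl⟩ := LExp.sym_apps_inj (as := []) ha
    simp
  | app e₁ e₂ ih₁ ih₂ =>
    intro h as ha c hc r
    rcases List.eq_nil_or_concat' as with rfl | ⟨bs, b, rfl⟩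
    · exact nomatch ha
    · rw [LExp.apps_concat] at ha
      injection ha with h1 h2
      subst h2
      rcases List.mem_append.1 hc with hc | hc
      · exact ih₁ h bs h1 c hc r
      · rw [List.mem_singleton.1 hc]; exact bot_of_args _ ih₂ r
  | _ =>
    intro h as ha
    rcases List.eq_nil_or_concat' as with rfl | ⟨bs, b, rfl⟩
    · exact nomatch ha
    · rw [LExp.apps_concat] at ha; exact nomatch ha

/-- HOlet-rewriting simulates the calculus. -/
theorem Derives.simulate {e t : PExp S V} (H : Derives P e t) (ht : t ≠ Exp.bot) {a : LExp S V}
    (ha : Cover e a) : Ev P (fun p => p.IsPat ∧ Cover t p) a := by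
  -- An expression with value `⊥` need not evaluate to a pattern at all, so such arguments are
  -- shared, not evaluated; all others use the induction hypothesis.
  have arg {e t : PExp S V} (h : t ≠ Exp.bot → ∀ {a : LExp S V}, Cover e a →
      Ev P (fun p => p.IsPat ∧ Cover t p) a) (c : LExp S V) (hc : Cover e c) (r : ℕ → ℕ) :
      ArgEv P t (c.rename r) := by
    by_cases ht : t = Exp.bot
    · rw [ht]; exact .bot _
    · exact .of_ev (h ht (hc.rename r))
  induction H generalizing a with
  | B e => exact absurd rfl ht
  | RR x =>
    refine .done ⟨?_, ha⟩
    obtain rfl := Cover.eq_toL (e := Exp.var x) ha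
    exact .fvar x
  | DC h es ts hl hd hp ih =>
    obtain ⟨cs, rfl, hcs⟩ := ha.sym_apps_inv
    refine (Ev.sym_apps h (forall₂_of_zip hl (fun p hp => arg (ih p hp)) hcs)).mono ?_
    rintro _ ⟨ps, rfl, hps⟩
    obtain ⟨hl', hp', hc'⟩ := forall₂_isPat hps
    exact .done ⟨.apps _ _ (hl' ▸ patArity_symToBot.1 (isPat_sym_apps_iff.1 hp).1) hp',
      (Cover.sym h).apps hc'⟩
  | OR ρ θ es as t hρ hθ hl hd hr ih ihr =>
    rw [Exp.apps_append] at ha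
    obtain ⟨b, ds, rfl, hb, hds⟩ := ha.apps_inv
    obtain ⟨cs, rfl, hcs⟩ := hb.sym_apps_inv
    have hargs := forall₂_of_zip (T := fun p c => ∀ r, ArgEv P (p.toBot.subst θ) (c.rename r)) hl
      (fun p hp => arg (ih p hp)) hcs
    rw [← List.forall₂_map_left_iff (f := fun p : Exp S V => p.toBot.subst θ)
      (R := fun t (c : LExp S V) => ∀ r, ArgEv P t (c.rename r))] at hargs
    refine Ev.apps_left ?_ (Ev.sym_apps _ hargs) hds
    rintro _ ds ⟨ps, rfl, hps⟩ hds
    obtain ⟨hl', hp', hc'⟩ := forall₂_isPat hps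
    have hlhs : Cover (ρ.lhs.toBot.subst θ) ((LExp.sym (Sum.inl ρ.fn)).apps ps) := by
      rw [Rule.lhs, toBot_apps, subst_apps, List.map_map]
      exact (Cover.sym _).apps hc'
    obtain ⟨σ, hσ, hcov⟩ := exists_matching (by rw [ρ.vars_lhs]; exact ρ.linear) hlhs
    classical
    -- The matcher is controlled only on the rule's variables, whereas `Fapp` asks for patterns
    -- everywhere.
    let τ : V → LExp S V := fun x => if x ∈ ρ.lhs.vars then σ x else .fvar x
    have hστ : ∀ x ∈ ρ.lhs.vars, σ x = τ x := fun x hx => by simp [τ, hx]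
    rw [subst_congrL hστ] at hσ
    have hτ : ∀ x, (τ x).IsPat := by
      intro x
      by_cases hx : x ∈ ρ.lhs.vars
      · rw [ρ.vars_lhs, List.mem_flatMap] at hx
        obtain ⟨p, hp, hx⟩ := hx
        rw [Rule.lhs, substL_apps] at hσ
        obtain ⟨-, rfl⟩ := LExp.sym_apps_inj hσ
        exact isPat_of_substL (ρ.isPat_args p hp) (hp' _ (List.mem_map_of_mem hp)) x hx
      · simp only [τ, hx, if_false]
        exact .fvar x
    rw [hσ]
    refine .step (LetStep.apps (.Fapp ρ τ hρ hτ) ds) (ihr ht (Cover.apps (Cover.subst ?_) hds))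
    intro x hx
    have hx' := P.noExtraVars ρ hρ x hx
    rw [← hστ x hx']
    exact hcov x hx'

theorem Derives.letRewrites {e t : Exp S V} (H : Derives P e.toBot t.toBot) :
    LetRewrites P e t := by
  have ht : t.toBot ≠ Exp.bot := by
    intro h
    rcases t with x | h | ⟨t₁, t₂⟩
    · exact absurd h (by intro h; cases h)
    · exact sym_apps_ne_bot (es := []) h
    · exact absurd h (by intro h; cases h)
  exact ((H.simulate ht (Cover.toL e)).mono fun p hp => .done hp.2.eq_toL).rewrites

theorem letRewrites_iff {e t : Exp S V} (ht : t.IsPat) :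
    LetRewrites P e t ↔ Derives P e.toBot t.toBot :=
  ⟨fun h => h.derives ht, fun h => h.letRewrites⟩

end HOCRWL

/-! ### Separating different denotations -/

namespace HOCRWL

variable {S : Signature.{u, v}} {V : Type w}

open Exp

theorem mem_obs {P : Program S V} {e t : Exp S V} :
    t ∈ obs P e ↔ t.IsPat ∧ Derives P e.toBot t.toBot :=
  and_congr_right letRewrites_iff

theorem mem_obsFO {P : Program S V} {e t : Exp S V} :
    t ∈ obsFO P e ↔ t.IsFOPat ∧ Derives P e.toBot t.toBot :=
  and_congr_right fun h => letRewrites_iff h.isPat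

/-- `h` applied to `n` patterns. -/
inductive Exp.Headed (h : S.Sym) : ℕ → Exp S V → Prop
  | sym : Headed h 0 (.sym h)
  | app {n : ℕ} {e a : Exp S V} : Headed h n e → a.IsPat → Headed h (n + 1) (.app e a)

theorem Exp.headed_iff {h : S.Sym} {n : ℕ} {e : Exp S V} :
    Headed h n e ↔ ∃ ts, e = (Exp.sym h).apps ts ∧ ts.length = n ∧ ∀ t ∈ ts, t.IsPat := by
  constructor
  · intro H
    induction H with
    | sym => exact ⟨[], rfl, rfl, by simp⟩
    | app _ ha ih =>
      obtain ⟨ts, rfl, rfl, h⟩ := ih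
      refine ⟨ts ++ [_], (apps_concat _ _ _).symm, by simp, fun t ht => ?_⟩
      rcases List.mem_append.1 ht with ht | ht
      · exact h t ht
      · rwa [List.mem_singleton.1 ht]
  · rintro ⟨ts, rfl, rfl, H⟩
    induction ts using List.reverseRecOn with
    | nil => exact .sym
    | append_singleton ts t ih =>
      rw [apps_concat, List.length_append]
      exact .app (ih fun a ha => H a (by simp [ha])) (H t (by simp))

theorem Exp.isPat_iff_headed {e : Exp S V} :
    e.IsPat ↔ (∃ x, e = var x) ∨ ∃ h n, S.PatArity h n ∧ Headed h n e := by
  constructor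
  · rintro (x | ⟨h, ts, h1, h2⟩)
    · exact Or.inl ⟨x, rfl⟩
    · exact Or.inr ⟨h, _, h1, headed_iff.2 ⟨ts, rfl, rfl, h2⟩⟩
  · rintro (⟨x, rfl⟩ | ⟨h, n, h1, h2⟩)
    · exact .var x
    · obtain ⟨ts, rfl, rfl, h⟩ := headed_iff.1 h2
      exact .apps _ _ h1 h

theorem Exp.toBot_subst_congr {θ τ : V → PExp S V} {e : Exp S V}
    (H : ∀ x ∈ e.vars, θ x = τ x) : e.toBot.subst θ = e.toBot.subst τ := by
  induction e with
  | var x => exact H x (by simp [vars])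
  | sym h => rfl
  | app e₁ e₂ ih₁ ih₂ =>
    simp only [toBot, subst]
    rw [ih₁ fun x hx => H x (by simp [vars, hx]), ih₂ fun x hx => H x (by simp [vars, hx])]

/-- `Linearization t p ys xs`: the linear expression `p` arises from the partial expression `t` by
replacing each occurrence of a variable or of `⊥` by a new variable; `ys` lists the new variables
that stand for the occurrences `xs` of variables. -/
structure Linearization (t : PExp S V) (p : Exp S V) (ys xs : List V) : Prop where
  nodup : p.vars.Nodup
  subset : ∀ y ∈ ys, y ∈ p.vars
  length_eq : ys.length = xs.length
  isPat : t.IsPat → p.IsPat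
  headed : ∀ h n, Headed (S.symToBot h) n t → Headed h n p
  exists_subst : ∃ θ : V → PExp S V, (∀ x, (θ x).IsPat) ∧ p.toBot.subst θ = t ∧
    ys.map θ = xs.map Exp.var
  derives : ∀ (P : Program S V) (θ : V → PExp S V), t.IsPat → ys.map θ = xs.map Exp.var →
    Derives P (p.toBot.subst θ) t

/-- Induction on `t`, with fresh variables at the leaves that are variables or `⊥`. The set `F` of
forbidden variables keeps the two sides of an application disjoint, hence `p` linear. -/
theorem exists_linearization [Infinite V] (t : PExp S V) (F : Finset V) :
    ∃ p ys xs, Linearization t p ys xs ∧ ∀ x ∈ p.vars, x ∉ F := by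
  classical
  induction t generalizing F with
  | var x =>
    obtain ⟨y, hy⟩ := Infinite.exists_notMem_finset F
    refine ⟨.var y, [y], [x], ⟨by simp [vars], by simp [vars], rfl, fun _ => .var y,
      (fun h n hh => by cases hh), ⟨fun _ => .var x, fun _ => .var x, rfl, rfl⟩, ?_⟩,
      by simpa [vars] using hy⟩
    intro P θ _ hθ
    have : θ y = .var x := by simpa using hθ
    simp only [toBot, subst, this]
    exact .RR x
  | sym h =>
    rcases eq_bot_or_symToBot h with rfl | ⟨g, rfl⟩
    · obtain ⟨y, hy⟩ := Infinite.exists_notMem_finset F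
      refine ⟨.var y, [], [], ⟨by simp [vars], by simp, rfl, fun _ => .var y,
        (fun h n hh => ?_), ⟨fun _ => bot, fun _ => isPat_bot, rfl, rfl⟩, fun P θ _ _ => .B _⟩,
        by simpa [vars] using hy⟩
      obtain ⟨ts, h1, -⟩ := headed_iff.1 hh
      exact absurd h1.symm sym_apps_ne_bot
    · refine ⟨.sym g, [], [], ⟨by simp [vars], by simp, rfl, fun hp => ?_, fun h n hh => ?_,
        ⟨.var, .var, rfl, rfl⟩, fun P θ hp _ => Derives.refl hp⟩, by simp [vars]⟩
      · exact .apps g [] (patArity_symToBot.1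
          (isPat_sym_apps_iff (ts := []).1 hp).1) (by simp)
      · obtain ⟨ts, h1, rfl, -⟩ := headed_iff.1 hh
        obtain ⟨hgh, rfl⟩ := sym_apps_inj (as := []) h1
        rw [symToBot_injective hgh]
        exact .sym
  | app t₁ t₂ ih₁ ih₂ =>
    obtain ⟨p₁, ys₁, xs₁, L₁, hF₁⟩ := ih₁ F
    obtain ⟨p₂, ys₂, xs₂, L₂, hF₂⟩ := ih₂ (F ∪ p₁.vars.toFinset)
    have hne : ∀ x ∈ p₂.vars, x ∉ p₁.vars := fun x hx h => hF₂ x hx (by simp [h])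
    -- Whether an application is a pattern depends on its head and the number of arguments, so these
    -- are carried through the induction.
    have headed : ∀ h n, Headed (S.symToBot h) n (app t₁ t₂) → Headed h n (app p₁ p₂) := by
      intro h n hh
      cases hh with
      | app h1 h2 => exact .app (L₁.headed _ _ h1) (L₂.isPat h2)
    refine ⟨.app p₁ p₂, ys₁ ++ ys₂, xs₁ ++ xs₂, ⟨?_, ?_, ?_, ?_, headed, ?_, ?_⟩, ?_⟩
    · exact List.nodup_append.2 ⟨L₁.nodup, L₂.nodup, fun a ha b hb hab => hne b hb (hab ▸ ha)⟩
    · intro y hy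
      rcases List.mem_append.1 hy with hy | hy
      · simp [vars, L₁.subset y hy]
      · simp [vars, L₂.subset y hy]
    · simp [L₁.length_eq, L₂.length_eq]
    · intro hp
      rcases isPat_iff_headed.1 hp with ⟨x, hx⟩ | ⟨h, n, h1, h2⟩
      · exact nomatch hx
      · rcases eq_bot_or_symToBot h with rfl | ⟨g, rfl⟩
        · obtain rfl := Nat.le_zero.1 h1
          exact nomatch h2
        · exact isPat_iff_headed.2 (Or.inr ⟨g, n, patArity_symToBot.1 h1, headed _ _ h2⟩)
    · obtain ⟨θ₁, hp₁, h₁, hm₁⟩ := L₁.exists_subst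
      obtain ⟨θ₂, hp₂, h₂, hm₂⟩ := L₂.exists_subst
      have e₁ : ∀ x ∈ p₁.vars, (if x ∈ p₁.vars then θ₁ x else θ₂ x) = θ₁ x := fun x hx => by
        simp [hx]
      have e₂ : ∀ x ∈ p₂.vars, (if x ∈ p₁.vars then θ₁ x else θ₂ x) = θ₂ x := fun x hx => by
        simp [hne x hx]
      refine ⟨fun x => if x ∈ p₁.vars then θ₁ x else θ₂ x, fun x => ?_, ?_, ?_⟩
      · dsimp only
        split_ifs
        exacts [hp₁ x, hp₂ x]
      · simp only [toBot, subst]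
        rw [toBot_subst_congr e₁, toBot_subst_congr e₂, h₁, h₂]
      · rw [List.map_append, List.map_append, ← hm₁, ← hm₂]
        congr 1
        · exact List.map_congr_left fun y hy => e₁ y (L₁.subset y hy)
        · exact List.map_congr_left fun y hy => e₂ y (L₂.subset y hy)
    · intro P θ hp hθ
      rw [List.map_append, List.map_append] at hθ
      obtain ⟨hθ₁, hθ₂⟩ := List.append_inj hθ (by simp [L₁.length_eq])
      exact (L₁.derives P θ (isPat_app hp).1 hθ₁).app_of_values
        (L₂.derives P θ (isPat_app hp).2.1 hθ₂) (Derives.refl hp)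
    · intro x hx
      rcases List.mem_append.1 hx with hx | hx
      · exact hF₁ x hx
      · exact fun h => hF₂ x hx (by simp [h])

theorem Exp.finite_syms (e : Exp S V) : e.syms.Finite := by
  induction e with
  | var x => exact Set.finite_empty
  | sym h => exact Set.finite_singleton h
  | app e₁ e₂ ih₁ ih₂ => exact ih₁.union ih₂

theorem Program.finite_syms (P : Program S V) : P.syms.Finite := by
  have : P.syms = ⋃ ρ ∈ P.rules, ρ.syms := by ext h; simp [Program.syms]
  rw [this]
  exact P.finite.biUnion fun ρ _ => (Exp.finite_syms _).union (Exp.finite_syms _)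

/-- A value of `e` that `e'` lacks is observed by some safe extension and context. -/
theorem exists_separating [Infinite V] (hFS : ∀ n : ℕ, {f : S.FS | S.arF f = n}.Infinite)
    (hCS : ∀ n : ℕ, {c : S.CS | S.arC c = n}.Infinite) {P : Program S V} {e e' : Exp S V}
    {t : PExp S V} (he : Derives P e.toBot t) (he' : ¬ Derives P e'.toBot t) :
    ∃ (P' : Program S V) (C : Cntxt S V) (s : Exp S V), P.SafeExtension e P' ∧
      P.SafeExtension e' P' ∧ C.syms ⊆ P'.syms ∧ s.IsFOPat ∧
      Derives P' (C.fill e).toBot s.toBot ∧ ¬ Derives P' (C.fill e').toBot s.toBot := by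
  obtain ⟨p, ys, xs, L, -⟩ := exists_linearization t ∅
  obtain ⟨d, hd⟩ := (hCS ys.length).nonempty
  have hfin : (Sum.inl ⁻¹' (P.syms ∪ e.syms ∪ e'.syms) : Set S.FS).Finite :=
    ((P.finite_syms.union e.finite_syms).union e'.finite_syms).preimage
      Sum.inl_injective.injOn
  obtain ⟨g, hg1, hg⟩ := ((hFS 1).sdiff hfin).nonempty
  simp only [Set.mem_preimage, Set.mem_union, not_or] at hg
  obtain ⟨⟨hgP, hge⟩, hge'⟩ := hg
  have hp := L.isPat he.isPat
  -- The test `g p → d y₁ … yₖ`: matching `p` checks the shape of the value, and `d` exposes what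
  -- stands at the variable occurrences of `t`.
  let ρ : Rule S V :=
    { fn := g
      args := [p]
      rhs := (sym (Sum.inr d)).apps (ys.map var)
      length_args := by simpa using hg1.symm
      isPat_args := by simpa using hp
      linear := by simpa using L.nodup }
  let P' : Program S V :=
    { rules := P.rules ∪ {ρ}
      finite := P.finite.union (Set.finite_singleton ρ)
      noExtraVars := by
        rintro σ (hσ | rfl)
        · exact P.noExtraVars σ hσ
        · intro x hx
          rw [Rule.vars_lhs]
          simp only [ρ, vars_apps, vars, List.nil_append, List.mem_flatMap, List.mem_map] at hx ⊢
          obtain ⟨_, ⟨y, hy, rfl⟩, hx⟩ := hx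
          exact ⟨p, by simp, by rw [List.mem_singleton.1 hx]; exact L.subset y hy⟩ }
  have hsafe {a : Exp S V} (ha : Sum.inl g ∉ a.syms) : P.SafeExtension a P' :=
    ⟨{ρ}, rfl, by rintro _ rfl; exact ⟨hgP, ha⟩⟩
  have hs : ((sym (Sum.inr d)).apps (xs.map var) : Exp S V).IsFOPat :=
    .apps d _ (by rw [List.length_map, ← L.length_eq]; exact hd.symm) fun t ht => by
      obtain ⟨x, -, rfl⟩ := List.mem_map.1 ht
      exact .var x
  have hrhs (θ : V → PExp S V) : ρ.rhs.toBot.subst θ =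
      (sym (S.symToBot (Sum.inr d))).apps (ys.map θ) := by
    simp only [ρ, toBot_apps, subst_apps, List.map_map]
    rfl
  have hsb : ((sym (Sum.inr d)).apps (xs.map var) : Exp S V).toBot =
      (sym (S.symToBot (Sum.inr d))).apps (xs.map var) := by
    rw [toBot_apps, List.map_map]
    rfl
  refine ⟨P', .appR (.sym (Sum.inl g)) .hole, _, hsafe hge, hsafe hge', ?_, hs, ?_, fun H => he' ?_⟩
  · rintro h (hh | hh)
    · refine ⟨ρ, Or.inr rfl, Or.inl ?_⟩
      rw [Set.mem_singleton_iff.1 hh]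
      exact mem_syms_apps.2 (Or.inl rfl)
    · exact hh.elim
  · obtain ⟨θ, hθ, hpθ, hys⟩ := L.exists_subst
    refine Derives.OR (P := P') ρ θ [e.toBot] [] _ (Or.inr rfl) hθ rfl ?_ ?_
    · intro q hq
      obtain rfl : q = (e.toBot, p) := by simpa [ρ] using hq
      simp only [hpθ]
      exact (hsafe hge).derives_iff.2 he
    · change Derives P' (ρ.rhs.toBot.subst θ) _
      rw [hrhs, hys, ← hsb]
      exact Derives.refl (toBot_isPat hs.isPat)
  · rw [hsb] at H
    rcases Derives.sym_apps_inv (h := Sum.inl g) (es := [e'.toBot]) H with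
      h | ⟨ts, -, -, h⟩ | ⟨σ, θ, us, as, hσ, hg, hu, hθ, hl, hd', hr⟩
    · exact absurd h sym_apps_ne_bot
    · exact nomatch symToBot_injective (sym_apps_inj h).1
    -- The rules of `P` cannot define the fresh `g`, so the new rule was used.
    · rcases hσ with hσ | rfl
      · refine absurd ?_ hgP
        rw [hg]
        exact ⟨σ, hσ, Or.inl (mem_syms_apps.2 (Or.inl rfl))⟩
      · have hl1 : us.length = 1 := hl
        obtain ⟨u, rfl⟩ := List.length_eq_one_iff.1 hl1
        obtain ⟨rfl, rfl⟩ : e'.toBot = u ∧ as = [] := by simpa [eq_comm] using hu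
        have h1 : Derives P' e'.toBot (p.toBot.subst θ) := hd' (_, p) (by simp [ρ])
        rw [hrhs] at hr
        -- Since `e'` has the value `pθ`, it remains to show `yᵢθ = xᵢ`; this follows because the
        -- patterns `yᵢθ` have the values `xᵢ`.
        refine (hsafe hge').derives_iff.1 (h1.trans (L.derives P' θ he.isPat ?_))
        rcases Derives.sym_apps_inv hr with h | ⟨ts, hlt, hts, h⟩ | ⟨_, _, _, _, _, h, -⟩
        · exact absurd h sym_apps_ne_bot
        · obtain ⟨-, rfl⟩ := sym_apps_inj h
          refine List.ext_getElem (by simpa using hlt) fun i hi hi' => ?_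
          have := hts ((ys.map θ)[i], (xs.map var)[i]) (by
            rw [← List.getElem_zip (h := by rw [List.length_zip]; omega)]
            exact List.getElem_mem _)
          simp only [List.getElem_map] at this ⊢
          exact Derives.isPat_to_var (hθ _) this
        · exact nomatch h

/-- The denotation is fully abstract for every observation that consists of the values in a class
of patterns containing the first-order ones. -/
theorem fullyAbstract_of_mem_iff [Infinite V] (hFS : ∀ n : ℕ, {f : S.FS | S.arF f = n}.Infinite)
    (hCS : ∀ n : ℕ, {c : S.CS | S.arC c = n}.Infinite) {Q : Exp S V → Prop}
    (hQ : ∀ t, t.IsFOPat → Q t) {O : Program S V → Exp S V → Set (Exp S V)}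
    (hO : ∀ P e t, t ∈ O P e ↔ Q t ∧ Derives P e.toBot t.toBot) :
    FullyAbstract (den (S := S) (V := V)) O := by
  intro P e e'
  constructor
  · intro h P' h1 h2 C _
    have key (t : PExp S V) : Derives P' e.toBot t ↔ Derives P' e'.toBot t := by
      rw [h1.derives_iff, h2.derives_iff, ← mem_den, ← mem_den, h]
    ext t
    rw [hO, hO, derives_fill_iff key]
  · intro H
    have sep {a a' : Exp S V} (H : ∀ P', P.SafeExtension a P' → P.SafeExtension a' P' →
        ∀ C : Cntxt S V, C.syms ⊆ P'.syms → O P' (C.fill a) = O P' (C.fill a')) :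
        den P a ⊆ den P a' := by
      intro t ht
      rw [mem_den] at ht ⊢
      by_contra ht'
      obtain ⟨P', C, s, h1, h2, h3, h4, h5, h6⟩ := exists_separating hFS hCS ht ht'
      have : s ∈ O P' (C.fill a) := (hO _ _ _).2 ⟨hQ s h4, h5⟩
      rw [H P' h1 h2 C h3, hO] at this
      exact h6 this.2
    exact (sep H).antisymm (sep fun P' h1 h2 C h3 => (H P' h2 h1 C h3).symm)

end HOCRWL

theorem mainTheorem1 (S : HOCRWL.Signature.{u, v}) (V : Type w) [Infinite V]
    (hFS : ∀ n : ℕ, {f : S.FS | S.arF f = n}.Infinite)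
    (hCS : ∀ n : ℕ, {c : S.CS | S.arC c = n}.Infinite) :
    HOCRWL.FullyAbstract (HOCRWL.den (S := S) (V := V)) HOCRWL.obs ∧
      HOCRWL.FullyAbstract (HOCRWL.den (S := S) (V := V)) HOCRWL.obsFO :=
  ⟨HOCRWL.fullyAbstract_of_mem_iff hFS hCS (fun _ h => h.isPat) fun _ _ _ => HOCRWL.mem_obs,
    HOCRWL.fullyAbstract_of_mem_iff hFS hCS (fun _ h => h) fun _ _ _ => HOCRWL.mem_obsFO⟩
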